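/- **Lemma (Bound on the $H^2$ smoothing operator).** Let $\mathcal T$ be a finite conforming tetrahedral mesh in $\mathbb R^3$ triangulating $\Omega$ (so $\overline\Omega=\bigcup_{T\in\mathcal T}T$), shape regular with parameter $\gamma$ (every $T\in\mathcal T$ contains a ball of radius $r$ with $h_T:=\operatorname{diam}T\le\gamma r$), and such that any two tetrahedra sharing a vertex or an edge are linked by a chain of tetrahedra containing that vertex or edge in which consecutive ones share a triangular face (as is the case for Lipschitz polyhedral domains). Put $h=\max_{T}h_T$. Let $\mathcal F(\mathcal T)$ be the set of faces; for a vertex $p$ (edge midpoint $m$) let $\mathcal T^p$ ($\mathcal T^m$) be the set of tetrahedra and $\mathcal F^p$ ($\mathcal F^m$) the set of interior faces containing it; let $\mathcal V(T)$, $\mathcal M(T)$ be the vertices and edge midpoints of $T$. For every edge $e$ let $e_{\perp,1},e_{\perp,2}$ be orthonormal vectors orthogonal to $e$. *Worsey–Farin splines.* Each $T$ is split at its incenter $c_T$, and each face $F$ at a point $f_F$ of its relative interior, which for a face shared by $T,T'$ is the intersection of $F$ with the line through $c_T,c_{T'}$; the twelve subtetrahedra of $T$ are spanned by $c_T$, $f_F$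 and an edge of $F$, where $F$ runs through the faces of $T$. $\mathcal{WF}(T)$ is the space of $C^1$ functions on $T$ that are polynomials of degree at most $3$ on each subtetrahedron, and $W_{\mathcal T}$ is the space of $w\in H^2(\Omega)\cap C^1(\overline\Omega)$ with $w|_T\in\mathcal{WF}(T)$ for all $T$. *Smoothing operator.* Let $V^k_{\mathcal T}$ be the space of $u\in L_2(\Omega)$ such that $u_T:=u|_T$ is a polynomial of degree at most $k$ for every $T\in\mathcal T$. For $u\in V^k_{\mathcal T}$, $E(u)\in W_{\mathcal T}$ is the spline with $$E(u)(p)=\frac1{|\mathcal T^p|}\sum_{T\in\mathcal T^p}u_T(p),\qquad \nabla E(u)(p)=\frac1{|\mathcal T^p|}\sum_{T\in\mathcal T^p}\nabla u_T(p)$$ for all vertices $p$ of the mesh, and, for all edges $e$ with midpoint $m$ and $i=1,2$, $$\frac{\partial E(u)}{\partial e_{\perp,i}}(m)=\frac1{|\mathcal T^m|}\sum_{T\in\mathcal T^m}\frac{\partial u_T}{\partial e_{\perp,i}}(m).$$ *Jumps.* $[\![\cdot]\!]_F$ is the difference of the traces from the two tetrahedra sharing $F$, and $0$ on boundary faces.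 In sums over $F\in\mathcal F^m$ below, $e$ is the edge with midpoint $m$; in sums over $F\in\mathcal F^p$ or $F\in\mathcal F(\mathcal T)$, $e$ is an arbitrarily chosen edge of $F$. Write $D_F(u)=\big\|[\![\partial u/\partial e_{\perp,1}]\!]_F\big\|^2_{L_2(F)}+\big\|[\![\partial u/\partial e_{\perp,2}]\!]_F\big\|^2_{L_2(F)}$. *Claim.* There is a constant $C>0$ depending only on $\gamma$ such that, for all such meshes, all $1\le k\le 3$ and all $u\in V^k_{\mathcal T}$: for every $T\in\mathcal T$, $$\|u-E(u)\|^2_{L_2(T)}\le C\Big(\sum_{p\in\mathcal V(T)}\sum_{F\in\mathcal F^p}h\,\|[\![u]\!]_F\|^2_{L_2(F)}+\sum_{p\in\mathcal V(T)}\sum_{F\in\mathcal F^p}h^3D_F(u)+\sum_{m\in\mathcal M(T)}\sum_{F\in\mathcal F^m}h^3D_F(u)\Big),$$ and $$\|u-E(u)\|^2_{L_2(\Omega)}\le C\Big(\sum_{F\in\mathcal F(\mathcal T)}h\,\|[\![u]\!]_F\|^2_{L_2(F)}+\sum_{F\in\mathcal F(\mathcal T)}h^3D_F(u)\Big).$$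 -/

import Mathlib

open MeasureTheory
open scoped ContDiff

namespace WF

/-- Euclidean three-space. -/
abbrev E3 : Type := EuclideanSpace ℝ (Fin 3)

/-! ### Tetrahedral meshes -/

/-- A conforming tetrahedral mesh: a finite geometric simplicial complex in `ℝ³` in which every
simplex is a face of a tetrahedron. Simplices are given by their vertex sets. -/
structure TetMesh extends Geometry.SimplicialComplex ℝ E3 where
  finite : faces.Finite
  pure : ∀ s ∈ faces, ∃ T ∈ faces, s ⊆ T ∧ T.card = 4

/-- The closed simplex with vertex set `s`. -/
def hull (s : Finset E3) : Set E3 := convexHull ℝ (s : Set E3)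

namespace TetMesh

/-- The simplices of the mesh with `n` vertices: `n = 4` tetrahedra, `n = 3` triangular faces,
`n = 2` edges, `n = 1` vertices. -/
noncomputable def simplices (K : TetMesh) (n : ℕ) : Finset (Finset E3) :=
  K.finite.toFinset.filter (fun s => s.card = n)

/-- The tetrahedra of the mesh. -/
noncomputable abbrev tets (K : TetMesh) : Finset (Finset E3) := K.simplices 4

/-- The closed domain, i.e. the union of all the closed tetrahedra. -/
def closedDomain (K : TetMesh) : Set E3 := K.toSimplicialComplex.space

/-- The open domain `Ω` that is triangulated by the mesh. -/
def domain (K : TetMesh) : Set E3 := interior K.closedDomain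

open Classical in
/-- The tetrahedra of the mesh that have the simplex `s` as a vertex, edge or face. -/
noncomputable def star (K : TetMesh) (s : Finset E3) : Finset (Finset E3) :=
  K.tets.filter (fun T => s ⊆ T)

open Classical in
/-- The interior faces (faces shared by different tetrahedra) that contain the simplex `s`. -/
noncomputable def interiorFaces (K : TetMesh) (s : Finset E3) : Finset (Finset E3) :=
  (K.simplices 3).filter (fun F => s ⊆ F ∧ 1 < (K.star F).card)

/-- The mesh size `h`, the largest diameter of a tetrahedron. -/
noncomputable def meshSize (K : TetMesh) : ℝ :=
  sSup ((fun T => Metric.diam (hull T)) '' (K.tets : Set (Finset E3)))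

/-- Shape regularity with parameter `γ`: every tetrahedron `T` contains a ball of radius `r` with
`diam T ≤ γ r`. -/
def ShapeRegular (K : TetMesh) (γ : ℝ) : Prop :=
  ∀ T ∈ K.tets, ∃ (x : E3) (r : ℝ), 0 < r ∧ Metric.closedBall x r ⊆ hull T ∧
    Metric.diam (hull T) ≤ γ * r

/-- Any two tetrahedra that share a simplex `s` of the mesh (a vertex or an edge, say) are linked
by a chain of tetrahedra containing `s` in which consecutive ones share a triangular face. -/
def LocallyFaceConnected (K : TetMesh) : Prop :=
  ∀ s ∈ K.faces, ∀ A ∈ K.star s, ∀ B ∈ K.star s,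
    Relation.ReflTransGen
      (fun P Q => P ∈ K.star s ∧ Q ∈ K.star s ∧ ∃ F ∈ K.simplices 3, F ⊆ P ∧ F ⊆ Q) A B

end TetMesh

/-! ### The Sobolev space `H²` -/

/-- `g` is the weak derivative of `f` in direction `v` on the open set `Ω`. -/
def HasWeakDeriv (Ω : Set E3) (f : E3 → ℝ) (v : E3) (g : E3 → ℝ) : Prop :=
  ∀ φ : E3 → ℝ, ContDiff ℝ ∞ φ → HasCompactSupport φ → tsupport φ ⊆ Ω →
    ∫ x in Ω, f x * fderiv ℝ φ x v = - ∫ x in Ω, g x * φ x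

/-- `f ∈ H²(Ω)`: `f` and its weak derivatives of orders one and two belong to `L²(Ω)`. -/
def MemH2 (Ω : Set E3) (f : E3 → ℝ) : Prop :=
  MemLp f 2 (volume.restrict Ω) ∧
  ∃ (g : Fin 3 → E3 → ℝ) (H : Fin 3 → Fin 3 → E3 → ℝ),
    (∀ i, MemLp (g i) 2 (volume.restrict Ω) ∧
      HasWeakDeriv Ω f (EuclideanSpace.single i 1) (g i)) ∧
    (∀ i j, MemLp (H i j) 2 (volume.restrict Ω) ∧
      HasWeakDeriv Ω (g i) (EuclideanSpace.single j 1) (H i j))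

/-! ### Piecewise polynomials and Worsey-Farin splines -/

/-- A polynomial in three variables as a function on `ℝ³`. -/
noncomputable def polyFun (P : MvPolynomial (Fin 3) ℝ) (x : E3) : ℝ :=
  MvPolynomial.eval (fun i => x i) P

/-- `u ∈ V^k`: the function `u ∈ L²(Ω)` agrees on each tetrahedron `T` with the polynomial `uT T`
of degree at most `k`. -/
def IsPiecewisePoly (K : TetMesh) (k : ℕ) (u : E3 → ℝ)
    (uT : Finset E3 → MvPolynomial (Fin 3) ℝ) : Prop :=
  MemLp u 2 (volume.restrict K.domain) ∧
  ∀ T ∈ K.tets, (uT T).totalDegree ≤ k ∧ ∀ᵐ x ∂(volume.restrict (hull T)), u x = polyFun (uT T) x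

/-- The points that define a Worsey-Farin split of the mesh: `c T` is the incenter of the
tetrahedron `T`, and `f F` is a point of the relative interior of the face `F`, which, if `F` is
shared by two tetrahedra, lies on the line through their incenters. -/
structure IsWFSplit (K : TetMesh) (c f : Finset E3 → E3) : Prop where
  incenter : ∀ T ∈ K.tets, ∃ s : Affine.Simplex ℝ E3 3,
    Set.range s.points = (T : Set E3) ∧ c T = s.incenter
  face_mem : ∀ F ∈ K.simplices 3, ∃ σ : E3 → ℝ,
    (∀ x ∈ F, 0 < σ x) ∧ ∑ x ∈ F, σ x = 1 ∧ f F = ∑ x ∈ F, σ x • x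
  collinear : ∀ F ∈ K.simplices 3, ∀ A ∈ K.star F, ∀ B ∈ K.star F, A ≠ B →
    f F ∈ line[ℝ, c A, c B]

/-- The (closed) subtetrahedron spanned by the edge `e` of the face `F` of the tetrahedron `T`,
the split point of `F` and the incenter of `T`. Each `T` has twelve of them. -/
def subTet (c f : Finset E3 → E3) (T F e : Finset E3) : Set E3 :=
  convexHull ℝ (insert (c T) (insert (f F) (e : Set E3)))

/-- `w ∈ WF(T)`: on the closed tetrahedron `T`, the function `w` is `C¹`, and it is a polynomial of
degree at most three on each of the twelve subtetrahedra. -/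
def MemWF (c f : Finset E3 → E3) (T : Finset E3) (w : E3 → ℝ) : Prop :=
  ContDiffOn ℝ 1 w (hull T) ∧
  ∀ F ∈ T.powersetCard 3, ∀ e ∈ F.powersetCard 2,
    ∃ P : MvPolynomial (Fin 3) ℝ, P.totalDegree ≤ 3 ∧ ∀ x ∈ subTet c f T F e, w x = polyFun P x

/-- The global `C¹` (hence `H²`) Worsey-Farin spline space. -/
def MemWFSpline (K : TetMesh) (c f : Finset E3 → E3) (w : E3 → ℝ) : Prop :=
  MemH2 K.domain w ∧ ContDiffOn ℝ 1 w K.closedDomain ∧ ∀ T ∈ K.tets, MemWF c f T w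

/-! ### Normal directions of edges, jumps, and the smoothing operator -/

/-- `ν e 0` and `ν e 1` are orthonormal vectors that are orthogonal to the edge `e`. -/
def IsEdgeFrame (K : TetMesh) (ν : Finset E3 → Fin 2 → E3) : Prop :=
  ∀ e ∈ K.simplices 2, Orthonormal ℝ (ν e) ∧
    ∀ x ∈ e, ∀ y ∈ e, ∀ i, inner ℝ (ν e i) (x - y) = 0

/-- `η` selects an edge of each face. -/
def IsEdgeChoice (K : TetMesh) (η : Finset E3 → Finset E3) : Prop :=
  ∀ F ∈ K.simplices 3, η F ∈ F.powersetCard 2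

/-- The squared norm `‖[[g]]_F‖²` in `L²(F)` (surface measure) of the jump across the face `F` of a
quantity with the trace `g T` from each adjacent tetrahedron `T`: for `F` shared by `A` and `B` it
is the integral of `(g A - g B)²`, and it is zero for a boundary face; see `faceJumpSq_pair` and
`faceJumpSq_boundary`. -/
noncomputable def faceJumpSq (K : TetMesh) (F : Finset E3) (g : Finset E3 → E3 → ℝ) : ℝ :=
  (1 / 2) * ∑ A ∈ K.star F, ∑ B ∈ K.star F,
    ∫ x in hull F, (g A x - g B x) ^ 2 ∂(Measure.euclideanHausdorffMeasure 2)

theorem faceJumpSq_pair (K : TetMesh) (F A B : Finset E3) (g : Finset E3 → E3 → ℝ)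
    (hAB : A ≠ B) (h : ∀ T, T ∈ K.star F ↔ T = A ∨ T = B) :
    faceJumpSq K F g =
      ∫ x in hull F, (g A x - g B x) ^ 2 ∂(Measure.euclideanHausdorffMeasure 2) := by
  classical
  have hs : K.star F = {A, B} := by
    ext T
    simp [h T]
  have hc : ∀ x, (g B x - g A x) ^ 2 = (g A x - g B x) ^ 2 := fun x => by ring
  simp only [faceJumpSq, hs, Finset.sum_pair hAB, hc]
  simp only [sub_self, ne_eq, OfNat.ofNat_ne_zero, not_false_eq_true, zero_pow, integral_zero]
  ring

theorem faceJumpSq_boundary (K : TetMesh) (F A : Finset E3) (g : Finset E3 → E3 → ℝ)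
    (h : ∀ T, T ∈ K.star F ↔ T = A) : faceJumpSq K F g = 0 := by
  have hs : K.star F = {A} := by
    ext T
    simp [h T]
  simp [faceJumpSq, hs]

/-- `‖[[u]]_F‖²` in `L²(F)`. -/
noncomputable def jumpSq (K : TetMesh) (uT : Finset E3 → MvPolynomial (Fin 3) ℝ)
    (F : Finset E3) : ℝ :=
  faceJumpSq K F (fun T x => polyFun (uT T) x)

/-- `‖[[∂u/∂v]]_F‖²` in `L²(F)`. -/
noncomputable def derivJumpSq (K : TetMesh) (uT : Finset E3 → MvPolynomial (Fin 3) ℝ)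
    (F : Finset E3) (v : E3) : ℝ :=
  faceJumpSq K F (fun T x => fderiv ℝ (polyFun (uT T)) x v)

/-- The midpoint of an edge, given by its two end points. -/
noncomputable def edgeMid (e : Finset E3) : E3 := (1 / 2 : ℝ) • ∑ x ∈ e, x

/-- `w = E(u)`, where `uT` are the polynomial pieces of `u`: `w` is the Worsey-Farin spline whose
values and gradients at the vertices, and whose two normal derivatives at the edge midpoints, are
the averages of those of `u` over the adjacent tetrahedra. -/
structure IsSmoothing (K : TetMesh) (c f : Finset E3 → E3) (ν : Finset E3 → Fin 2 → E3)
    (uT : Finset E3 → MvPolynomial (Fin 3) ℝ) (w : E3 → ℝ) : Prop where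
  mem : MemWFSpline K c f w
  value : ∀ p : E3, {p} ∈ K.simplices 1 →
    w p = ((K.star {p}).card : ℝ)⁻¹ * ∑ T ∈ K.star {p}, polyFun (uT T) p
  grad : ∀ p : E3, {p} ∈ K.simplices 1 →
    fderivWithin ℝ w K.closedDomain p =
      ((K.star {p}).card : ℝ)⁻¹ • ∑ T ∈ K.star {p}, fderiv ℝ (polyFun (uT T)) p
  normal : ∀ e ∈ K.simplices 2, ∀ i : Fin 2,
    fderivWithin ℝ w K.closedDomain (edgeMid e) (ν e i) =
      ((K.star e).card : ℝ)⁻¹ *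
        ∑ T ∈ K.star e, fderiv ℝ (polyFun (uT T)) (edgeMid e) (ν e i)

end WF

/-! On a tetrahedron `T` the error `u_T - E(u)` is again a C¹ piecewise cubic on the split of `T`,
because `u_T` is a polynomial of degree at most 3. It is therefore enough to bound such a function
by its degrees of freedom (values and gradients at vertices, normal derivatives at edge midpoints)
and to bound those of the error by jumps of `u`.

Stability (`MemWF.abs_le_of_dofs`). Every cubic piece is replaced by its blossom, whose values at
the corners of the subtetrahedron are the Bézier coefficients. C¹ continuity means that the blossoms
of two pieces agree once two of the three arguments are common to both subtetrahedra
(`IsContact.agree`). A coefficient with a split point among its arguments is a convex combination of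
coefficients in which that point is replaced by vertices; by agreement, each of these can be
evaluated in another piece, one whose edge contains the vertices concerned. In the end only values
`b i j y` with `i`, `j` on a common edge remain (`IsContact.abs_control_le`). Since the weights are
convex, the bound does not depend on the position of the split points. The edge values are read off
from the degrees of freedom, and only the ratio of diameter to edge length enters.

Degrees of freedom. At a vertex or midpoint, those of the error are the value (or derivative) of
`u_T` minus the average over the surrounding tetrahedra. A chain through common faces bounds this by
the largest jump times the number of these tetrahedra (`TetMesh.norm_sub_average_le`), which is at
most about `γ ^ 3` by a packing argument (`ShapeRegular.card_star_le`).

Jumps. An inverse estimate on the face (`IsBlossom.sq_le_integral`) bounds pointwise jumps by L²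
norms. In the gradient jump, the component along an edge comes from the jump of `u` and the other
two from `D_F` (`sq_norm_gradient_jump_le`). Neighbouring tetrahedra have comparable sizes, so
everything scales with `h_T`: the squared error is at most a constant times `h_T⁻² ‖[u]‖² + D_F`,
and integration over `T` contributes the factor `h_T³`. Summation over `T` counts each face a
bounded number of times. -/

namespace WF

/-! ### Blossoms of cubic polynomials -/

/-- `b` is the blossom (polar form) of the cubic function `q`: a symmetric map that is affine in
each of its three arguments and equals `q` on the diagonal. -/
structure IsBlossom (b : E3 → E3 → E3 →ᵃ[ℝ] ℝ) (q : E3 → ℝ) : Prop where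
  diag : ∀ x, b x x x = q x
  swap : ∀ x y z, b x y z = b y x z
  swap' : ∀ x y z, b x y z = b x z y

/-- The blossom is the product symmetrized over the six permutations of its arguments. -/
theorem exists_isBlossom_mul (a₁ a₂ a₃ : E3 →ᵃ[ℝ] ℝ) :
    ∃ b, IsBlossom b (fun x => a₁ x * a₂ x * a₃ x) := by
  refine ⟨fun x y => (1 / 6 : ℝ) • ((a₁ x * a₂ y + a₁ y * a₂ x) • a₃ +
    (a₁ x * a₃ y + a₁ y * a₃ x) • a₂ + (a₂ x * a₃ y + a₂ y * a₃ x) • a₁), ?_, ?_, ?_⟩ <;>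
  intros <;> simp <;> ring

theorem IsBlossom.add {b b' : E3 → E3 → E3 →ᵃ[ℝ] ℝ} {q q' : E3 → ℝ} (h : IsBlossom b q)
    (h' : IsBlossom b' q') :
    IsBlossom (fun x y => b x y + b' x y) (fun x => q x + q' x) where
  diag x := by simp [h.diag, h'.diag]
  swap x y z := by simp [h.swap x, h'.swap x]
  swap' x y z := by simp [h.swap' x y, h'.swap' x y]

theorem IsBlossom.smul {b : E3 → E3 → E3 →ᵃ[ℝ] ℝ} {q : E3 → ℝ} (h : IsBlossom b q) (r : ℝ) :
    IsBlossom (fun x y => r • b x y) (fun x => r * q x) where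
  diag x := by simp [h.diag]
  swap x y z := by simp [h.swap x]
  swap' x y z := by simp [h.swap' x y]

/-- The coordinate function `x ↦ x i` as an affine map. -/
noncomputable def coordAffine (i : Fin 3) : E3 →ᵃ[ℝ] ℝ :=
  (EuclideanSpace.proj i : E3 →L[ℝ] ℝ).toLinearMap.toAffineMap

@[simp]
theorem coordAffine_apply (i : Fin 3) (x : E3) : coordAffine i x = x i := rfl

theorem exists_isBlossom_prod (m : Multiset (Fin 3)) (hm : m.card ≤ 3) :
    ∃ b, IsBlossom b (fun x => (m.map (fun i => x i)).prod) := by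
  have h : m.card = 0 ∨ m.card = 1 ∨ m.card = 2 ∨ m.card = 3 := by omega
  rcases h with h | h | h | h
  · obtain rfl := Multiset.card_eq_zero.1 h
    simpa using exists_isBlossom_mul (AffineMap.const ℝ E3 1) (AffineMap.const ℝ E3 1)
      (AffineMap.const ℝ E3 1)
  · obtain ⟨i, rfl⟩ := Multiset.card_eq_one.1 h
    simpa using exists_isBlossom_mul (coordAffine i) (AffineMap.const ℝ E3 1)
      (AffineMap.const ℝ E3 1)
  · obtain ⟨i, j, rfl⟩ := Multiset.card_eq_two.1 h
    simpa using exists_isBlossom_mul (coordAffine i) (coordAffine j) (AffineMap.const ℝ E3 1)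
  · obtain ⟨i, j, k, rfl⟩ := Multiset.card_eq_three.1 h
    simpa [mul_assoc] using exists_isBlossom_mul (coordAffine i) (coordAffine j) (coordAffine k)

theorem exists_isBlossom_sum {ι : Type*} (s : Finset ι) (q : ι → E3 → ℝ)
    (h : ∀ i ∈ s, ∃ b, IsBlossom b (q i)) : ∃ b, IsBlossom b (fun x => ∑ i ∈ s, q i x) := by
  classical
  induction s using Finset.induction_on with
  | empty => exact ⟨fun _ _ => 0, by simp, by simp, by simp⟩
  | insert i s hi ih =>
    obtain ⟨b, hb⟩ := h i (by simp)
    obtain ⟨b', hb'⟩ := ih fun j hj => h j (by simp [hj])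
    exact ⟨_, by simpa [Finset.sum_insert hi] using hb.add hb'⟩

/-- By linearity it suffices to treat monomials, and a monomial of degree at most 3 is a product of
three affine functions once it is padded with constants 1. -/
theorem exists_isBlossom_polyFun (P : MvPolynomial (Fin 3) ℝ) (hP : P.totalDegree ≤ 3) :
    ∃ b, IsBlossom b (polyFun P) := by
  have h : polyFun P = fun x => ∑ s ∈ P.support,
      P.coeff s * ((Finsupp.toMultiset s).map (fun i => x i)).prod := by
    funext x
    simp only [polyFun, MvPolynomial.eval_eq']
    refine Finset.sum_congr rfl fun s _ => ?_
    rw [Finsupp.toMultiset_apply, Finsupp.sum_fintype _ _ (by simp)]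
    simp [Fin.sum_univ_three, Fin.prod_univ_three, Multiset.map_nsmul, Multiset.prod_nsmul]
  rw [h]
  refine exists_isBlossom_sum _ _ fun s hs => ?_
  obtain ⟨b, hb⟩ := exists_isBlossom_prod (Finsupp.toMultiset s) (by
    rw [Finsupp.card_toMultiset]
    exact (MvPolynomial.le_totalDegree hs).trans hP)
  exact ⟨_, hb.smul _⟩

theorem differentiable_polyFun (P : MvPolynomial (Fin 3) ℝ) : Differentiable ℝ (polyFun P) := by
  have : polyFun P = fun x => ∑ s ∈ P.support, P.coeff s * ∏ i, x i ^ s i := by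
    funext x
    simp [polyFun, MvPolynomial.eval_eq']
  rw [this]
  fun_prop

namespace IsBlossom

variable {b : E3 → E3 → E3 →ᵃ[ℝ] ℝ} {q : E3 → ℝ}

theorem rotate (h : IsBlossom b q) (x y z : E3) : b x y z = b z x y := by
  rw [h.swap' x y z, h.swap x z y]

theorem line_right (_h : IsBlossom b q) (x y a a' : E3) (t : ℝ) :
    b x y (AffineMap.lineMap a a' t) = (1 - t) * b x y a + t * b x y a' := by
  rw [AffineMap.apply_lineMap, AffineMap.lineMap_apply_ring']
  ring

theorem line_mid (h : IsBlossom b q) (x y a a' : E3) (t : ℝ) :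
    b x (AffineMap.lineMap a a' t) y = (1 - t) * b x a y + t * b x a' y := by
  rw [h.swap', h.line_right, h.swap' x y, h.swap' x y]

theorem line_left (h : IsBlossom b q) (x y a a' : E3) (t : ℝ) :
    b (AffineMap.lineMap a a' t) x y = (1 - t) * b a x y + t * b a' x y := by
  rw [h.swap, h.line_mid, h.swap x, h.swap x]

theorem diag_lineMap (h : IsBlossom b q) (x y z : E3) (t : ℝ) :
    b (AffineMap.lineMap x y t) (AffineMap.lineMap x y t) z =
      (1 - t) ^ 2 * b x x z + 2 * (1 - t) * t * b x y z + t ^ 2 * b y y z := by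
  rw [h.line_left, h.line_mid, h.line_mid, h.swap y x]
  ring

theorem apply_lineMap (h : IsBlossom b q) (x y : E3) (t : ℝ) :
    q (AffineMap.lineMap x y t) =
      (1 - t) ^ 3 * q x + 3 * (1 - t) ^ 2 * t * b x x y + 3 * (1 - t) * t ^ 2 * b x y y +
        t ^ 3 * q y := by
  rw [← h.diag, h.diag_lineMap, h.line_right, h.line_right, h.line_right, h.diag, h.diag,
    h.rotate y y x, h.swap' x y x]
  ring

/-- On the line from `x` to `x + v` the cubic is in Bernstein form, and its derivative at the start
is three times the difference of the first two coefficients. Hence the affine function `b x x`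
carries exactly the first order data of `q` at `x`. -/
theorem fderiv_apply (h : IsBlossom b q) {x : E3} (hq : DifferentiableAt ℝ q x) (v : E3) :
    fderiv ℝ q x v = 3 * (b x x (x + v) - q x) := by
  have hl : HasDerivAt (fun t : ℝ => AffineMap.lineMap x (x + v) t) v 0 := by
    simpa using AffineMap.hasDerivAt_lineMap (a := x) (b := x + v) (x := (0 : ℝ))
  have h1 : HasDerivAt (fun t : ℝ => q (AffineMap.lineMap x (x + v) t)) (fderiv ℝ q x v) 0 := by
    refine HasFDerivAt.comp_hasDerivAt (0 : ℝ) ?_ hl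
    simpa using hq.hasFDerivAt
  have h2 : HasDerivAt (fun t : ℝ => q (AffineMap.lineMap x (x + v) t))
      (3 * (b x x (x + v) - q x)) 0 := by
    simp only [h.apply_lineMap]
    have h3 : HasDerivAt (fun t : ℝ => 1 - t) (-1) 0 := by
      simpa using (hasDerivAt_id (0 : ℝ)).const_sub 1
    have h4 := hasDerivAt_id (0 : ℝ)
    convert! ((((h3.fun_pow 3).mul_const (q x)).fun_add
      ((((h3.fun_pow 2).const_mul 3).fun_mul h4).mul_const (b x x (x + v)))).fun_add
      (((h3.const_mul 3).fun_mul (h4.fun_pow 2)).mul_const (b x (x + v) (x + v)))).fun_add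
      ((h4.fun_pow 3).mul_const (q (x + v))) using 1
    simp
    ring
  exact h1.unique h2

/-- The derivative is quadratic, with symmetric form `3 * (b x y v - b x y 0)`. Degree elevation,
i.e. averaging over the three pairs of arguments, makes it a cubic blossom, so that the inverse
estimate for cubics also applies to derivatives. -/
theorem exists_fderiv (h : IsBlossom b q) (hq : Differentiable ℝ q) (v : E3) :
    ∃ b', IsBlossom b' (fun x => fderiv ℝ q x v) := by
  have hlin : ∀ x y z, b x y (z + v) = b x y z + (b x y v - b x y 0) := fun x y z => by
    have := (b x y).linearMap_vsub v 0
    have h2 := (b x y).map_vadd z v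
    simp only [vsub_eq_sub, sub_zero, vadd_eq_add] at this h2
    rw [add_comm, h2, this]
    ring
  refine ⟨fun x y => AffineMap.const ℝ E3 (b x y v - b x y 0) + (b x v - b x 0) + (b y v - b y 0),
    fun x => ?_, fun x y z => ?_, fun x y z => ?_⟩
  · rw [h.fderiv_apply (hq x), hlin, h.diag]
    simp only [AffineMap.coe_add, AffineMap.coe_sub, Pi.add_apply, Pi.sub_apply,
      AffineMap.const_apply, h.swap' x v x, h.swap' x 0 x]
    ring
  · simp only [AffineMap.coe_add, AffineMap.coe_sub, Pi.add_apply, Pi.sub_apply,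
      AffineMap.const_apply, h.swap x y]
    ring
  · simp only [AffineMap.coe_add, AffineMap.coe_sub, Pi.add_apply, Pi.sub_apply,
      AffineMap.const_apply]
    linear_combination h.swap' x v z - h.swap' x 0 z + h.swap' x y v - h.swap' x y 0 +
      h.rotate y v z - h.rotate y 0 z + h.swap' z y v - h.swap' z y 0

/-- Polarization: the blossom in terms of the values of the cubic. -/
theorem polarization (h : IsBlossom b q) (x y z : E3) :
    6 * b x y z = 27 * q (AffineMap.lineMap (AffineMap.lineMap x y (1 / 2 : ℝ)) z (1 / 3 : ℝ)) -
      8 * (q (AffineMap.lineMap x y (1 / 2 : ℝ)) + q (AffineMap.lineMap x z (1 / 2 : ℝ)) +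
        q (AffineMap.lineMap y z (1 / 2 : ℝ))) + q x + q y + q z := by
  rw [h.apply_lineMap _ z, h.diag_lineMap, h.line_left, h.apply_lineMap, h.apply_lineMap,
    h.apply_lineMap]
  ring

theorem abs_le_of_convex (h : IsBlossom b q) {S : Set E3} (hS : Convex ℝ S) {M : ℝ}
    (hM : ∀ x ∈ S, |q x| ≤ M) {x y z : E3} (hx : x ∈ S) (hy : y ∈ S) (hz : z ∈ S) :
    |b x y z| ≤ 9 * M := by
  have hl : ∀ {a a' : E3} {t : ℝ}, a ∈ S → a' ∈ S → 0 ≤ t → t ≤ 1 →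
      AffineMap.lineMap a a' t ∈ S :=
    fun ha ha' h0 h1 => hS.lineMap_mem ha ha' ⟨h0, h1⟩
  have hp := h.polarization x y z
  have hxy := hl hx hy (t := 1 / 2) (by norm_num) (by norm_num)
  have h1 := abs_le.1 (hM _ hx)
  have h2 := abs_le.1 (hM _ hy)
  have h3 := abs_le.1 (hM _ hz)
  have h4 := abs_le.1 (hM _ hxy)
  have h5 := abs_le.1 (hM _ (hl hx hz (t := 1 / 2) (by norm_num) (by norm_num)))
  have h6 := abs_le.1 (hM _ (hl hy hz (t := 1 / 2) (by norm_num) (by norm_num)))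
  have h7 := abs_le.1 (hM _ (hl hxy hz (t := 1 / 3) (by norm_num) (by norm_num)))
  -- The weights of the polarization formula give `(27 + 3 * 8 + 3) / 6 = 9`.
  rw [abs_le]
  constructor <;> linarith [h1.1, h1.2]

end IsBlossom

end WF

namespace WF

/-! ### Convex combinations and the geometry of the split -/

/-- `c` is a convex combination of the points of `S` with positive coefficients. -/
def IsPosComb (S : Finset E3) (c : E3) : Prop :=
  ∃ σ : E3 → ℝ, (∀ x ∈ S, 0 < σ x) ∧ ∑ x ∈ S, σ x = 1 ∧ c = ∑ x ∈ S, σ x • x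

theorem IsPosComb.mem_hull {S : Finset E3} {c : E3} (h : IsPosComb S c) : c ∈ hull S := by
  obtain ⟨σ, h0, h1, rfl⟩ := h
  exact Finset.mem_convexHull'.2 ⟨σ, fun x hx => (h0 x hx).le, h1, rfl⟩

theorem abs_affine_le_of_mem_convexHull (A : E3 →ᵃ[ℝ] ℝ) {S : Set E3} {M : ℝ}
    (h : ∀ x ∈ S, |A x| ≤ M) {x : E3} (hx : x ∈ convexHull ℝ S) : |A x| ≤ M := by
  have hc : Convex ℝ (A ⁻¹' Set.Icc (-M) M) := (convex_Icc (-M) M).affine_preimage A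
  exact abs_le.2 (convexHull_min (fun y hy => abs_le.1 (h y hy)) hc hx)

open Classical in
-- The largest multiple of `c` that leaves nonnegative weights is split off from `x`. The vertex `l`
-- minimizing `w l / σ l` then gets weight zero and drops out.
theorem IsPosComb.exists_mem_convexHull_insert_erase {S : Finset E3} {c x : E3}
    (h : IsPosComb S c) (hx : x ∈ hull S) :
    ∃ l ∈ S, x ∈ convexHull ℝ (insert c ((S.erase l : Finset E3) : Set E3)) := by
  obtain ⟨σ, h0, h1, rfl⟩ := h
  obtain ⟨w, hw0, hw1, rfl⟩ := Finset.mem_convexHull'.1 hx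
  have hne : S.Nonempty := by
    rw [Finset.nonempty_iff_ne_empty]
    rintro rfl
    simp at h1
  obtain ⟨l, hl, hmin⟩ := Finset.exists_min_image S (fun i => w i / σ i) hne
  refine ⟨l, hl, ?_⟩
  set c := ∑ x ∈ S, σ x • x with hc
  set s := w l / σ l with hs
  have hs0 : 0 ≤ s := div_nonneg (hw0 l hl) (h0 l hl).le
  have hsl : s * σ l = w l := div_mul_cancel₀ _ (h0 l hl).ne'
  have hconv := convex_convexHull ℝ (insert c ((S.erase l : Finset E3) : Set E3))
  have key := hconv.sum_mem (t := S) (w := fun i => if i = l then s else w i - s * σ i)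
    (z := fun i => if i = l then c else i) ?_ ?_ ?_
  · convert! key using 1
    have hw := Finset.add_sum_erase S (fun i => w i • i) hl
    have hsig := Finset.add_sum_erase S (fun i => σ i • i) hl
    rw [← hw, ← Finset.add_sum_erase S _ hl]
    simp only [if_true]
    have h2 : ∑ x ∈ S.erase l, (if x = l then s else w x - s * σ x) • (if x = l then c else x) =
        ∑ x ∈ S.erase l, w x • x - s • ∑ x ∈ S.erase l, σ x • x := by
      rw [Finset.smul_sum, ← Finset.sum_sub_distrib]
      refine Finset.sum_congr rfl fun i hi => ?_
      simp only [Finset.ne_of_mem_erase hi, if_false, sub_smul, mul_smul]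
    rw [h2]
    have h3 : c = σ l • l + ∑ x ∈ S.erase l, σ x • x := by rw [hc, ← hsig]
    rw [h3, smul_add, ← mul_smul, hsl]
    abel
  · intro i hi
    split_ifs with h
    · exact hs0
    · have := (le_div_iff₀ (h0 i hi)).1 (hmin i hi)
      linarith
  · rw [← Finset.add_sum_erase S _ hl]
    have h2 : ∑ x ∈ S.erase l, (if x = l then s else w x - s * σ x) =
        ∑ x ∈ S.erase l, w x - s * ∑ x ∈ S.erase l, σ x := by
      rw [Finset.mul_sum, ← Finset.sum_sub_distrib]
      refine Finset.sum_congr rfl fun i hi => ?_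
      simp only [Finset.ne_of_mem_erase hi, if_false]
    have hw := Finset.add_sum_erase S w hl
    have hsig := Finset.add_sum_erase S σ hl
    simp only [if_true]
    rw [h2]
    linear_combination hw - s * hsig + hw1 - s * h1 + hsl
  · intro i hi
    split_ifs with h
    · exact subset_convexHull ℝ _ (by simp)
    · exact subset_convexHull ℝ _ (by simp [h, hi])

open Classical in
-- The combination can be solved for `l` because `σ l > 0`: the vertex lies on the line through `c`
-- and the weighted mean `y` of the other vertices.
theorem IsPosComb.mem_affineSpan {S : Finset E3} {c l : E3} (h : IsPosComb S c) (hl : l ∈ S)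
    (hS : 1 < S.card) : l ∈ affineSpan ℝ (insert c ((S.erase l : Finset E3) : Set E3)) := by
  obtain ⟨σ, h0, h1, hc⟩ := h
  have hsum : σ l + ∑ i ∈ S.erase l, σ i = 1 := by rw [Finset.add_sum_erase S σ hl, h1]
  have hsumc : c = σ l • l + ∑ i ∈ S.erase l, σ i • i := by
    rw [Finset.add_sum_erase S (fun i => σ i • i) hl, hc]
  have hne : (S.erase l).Nonempty := by
    rw [← Finset.card_pos, Finset.card_erase_of_mem hl]
    omega
  have hpos : 0 < ∑ i ∈ S.erase l, σ i :=
    Finset.sum_pos (fun i hi => h0 i (Finset.mem_of_mem_erase hi)) hne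
  set τ := ∑ i ∈ S.erase l, σ i with hτ
  have hy : τ⁻¹ • ∑ i ∈ S.erase l, σ i • i ∈ hull (S.erase l) := by
    refine Finset.mem_convexHull'.2 ⟨fun i => τ⁻¹ * σ i, fun i hi => ?_, ?_, ?_⟩
    · exact mul_nonneg (inv_nonneg.2 hpos.le) (h0 i (Finset.mem_of_mem_erase hi)).le
    · rw [← Finset.mul_sum, ← hτ, inv_mul_cancel₀ hpos.ne']
    · simp [Finset.smul_sum, mul_smul]
  set y := τ⁻¹ • ∑ i ∈ S.erase l, σ i • i with hydef
  have hy' : ∑ i ∈ S.erase l, σ i • i = τ • y := by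
    rw [hydef, smul_smul, mul_inv_cancel₀ hpos.ne', one_smul]
  have hy2 : y ∈ affineSpan ℝ (insert c ((S.erase l : Finset E3) : Set E3)) :=
    affineSpan_mono ℝ (Set.subset_insert _ _) (convexHull_subset_affineSpan _ hy)
  have hc2 : c ∈ affineSpan ℝ (insert c ((S.erase l : Finset E3) : Set E3)) :=
    subset_affineSpan ℝ _ (Set.mem_insert _ _)
  clear_value y
  have hl' : l = AffineMap.lineMap y c (σ l)⁻¹ := by
    have hσ := (h0 l hl).ne'
    rw [AffineMap.lineMap_apply_module, hsumc, hy', smul_add, smul_smul (σ l)⁻¹,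
      smul_smul (σ l)⁻¹, inv_mul_cancel₀ hσ, one_smul, add_left_comm, ← add_smul]
    have : 1 - (σ l)⁻¹ + (σ l)⁻¹ * τ = 0 := by
      field_simp
      linarith
    rw [this, zero_smul, add_zero]
  have := AffineMap.lineMap_mem (σ l)⁻¹ hy2 hc2
  rwa [← hl'] at this

/-- `e` is an edge of the face `F` of the tetrahedron `T`. -/
structure IsFlag (T F e : Finset E3) : Prop where
  face_sub : F ⊆ T
  face_card : F.card = 3
  edge_sub : e ⊆ F
  edge_card : e.card = 2

/-- The case `i = j` is allowed, which also provides a subtetrahedron at a single vertex. -/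
theorem exists_isFlag {T : Finset E3} (hT : T.card = 4) {i j : E3} (hi : i ∈ T) (hj : j ∈ T) :
    ∃ F e, IsFlag T F e ∧ i ∈ e ∧ j ∈ e := by
  classical
  obtain ⟨e, h1, h2, h3⟩ := Finset.exists_subsuperset_card_eq (s := {i, j}) (t := T) (n := 2)
    (by simp [Finset.insert_subset_iff, hi, hj]) Finset.card_le_two (by omega)
  obtain ⟨F, h4, h5, h6⟩ := Finset.exists_subsuperset_card_eq (s := e) (t := T) (n := 3)
    h2 (by omega) (by omega)
  exact ⟨F, e, ⟨h5, h6, h4, h3⟩, h1 (by simp), h1 (by simp)⟩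

theorem IsFlag.exists_edge {T F e : Finset E3} (h : IsFlag T F e) {i j : E3} (hi : i ∈ F)
    (hj : j ∈ F) : ∃ e', IsFlag T F e' ∧ i ∈ e' ∧ j ∈ e' := by
  classical
  obtain ⟨e', h1, h2, h3⟩ := Finset.exists_subsuperset_card_eq (s := {i, j}) (t := F) (n := 2)
    (by simp [Finset.insert_subset_iff, hi, hj]) Finset.card_le_two (by rw [h.face_card]; omega)
  exact ⟨e', ⟨h.face_sub, h.face_card, h2, h3⟩, h1 (by simp), h1 (by simp)⟩

variable {c f : Finset E3 → E3} {T : Finset E3}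

theorem center_mem_subTet {F e : Finset E3} : c T ∈ subTet c f T F e :=
  subset_convexHull ℝ _ (by simp)

theorem faceCenter_mem_subTet {F e : Finset E3} : f F ∈ subTet c f T F e :=
  subset_convexHull ℝ _ (by simp)

theorem mem_subTet_of_mem_edge {F e : Finset E3} {i : E3} (hi : i ∈ e) : i ∈ subTet c f T F e :=
  subset_convexHull ℝ _ (by simp [hi])

theorem convex_subTet (F e : Finset E3) : Convex ℝ (subTet c f T F e) :=
  convex_convexHull ℝ _

theorem hull_mono {S S' : Finset E3} (h : S ⊆ S') : hull S ⊆ hull S' :=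
  convexHull_mono (by exact_mod_cast h)

theorem mem_hull {S : Finset E3} {x : E3} (h : x ∈ S) : x ∈ hull S :=
  subset_convexHull ℝ _ h

theorem subTet_subset_hull (hc : IsPosComb T (c T))
    (hf : ∀ F ∈ T.powersetCard 3, IsPosComb F (f F)) {F e : Finset E3} (h : IsFlag T F e) :
    subTet c f T F e ⊆ hull T := by
  refine convexHull_min ?_ (convex_convexHull ℝ _)
  rintro x (rfl | rfl | hx)
  · exact hc.mem_hull
  · exact hull_mono h.face_sub
      (hf F (Finset.mem_powersetCard.2 ⟨h.face_sub, h.face_card⟩)).mem_hull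
  · exact mem_hull (h.face_sub (h.edge_sub hx))

/-- The subtetrahedra of the split cover the tetrahedron. -/
theorem exists_mem_subTet (hT : T.card = 4) (hc : IsPosComb T (c T))
    (hf : ∀ F ∈ T.powersetCard 3, IsPosComb F (f F)) {x : E3} (hx : x ∈ hull T) :
    ∃ F e, IsFlag T F e ∧ x ∈ subTet c f T F e := by
  classical
  obtain ⟨l, hl, hxl⟩ := hc.exists_mem_convexHull_insert_erase hx
  have hFc : (T.erase l).card = 3 := by rw [Finset.card_erase_of_mem hl, hT]
  have hne : (T.erase l).Nonempty := by rw [← Finset.card_pos]; omega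
  rw [convexHull_insert (by exact_mod_cast hne), mem_convexJoin] at hxl
  obtain ⟨c', rfl, y, hy, hxy⟩ := hxl
  have hF := hf (T.erase l) (Finset.mem_powersetCard.2 ⟨Finset.erase_subset _ _, hFc⟩)
  obtain ⟨k, hk, hyk⟩ := hF.exists_mem_convexHull_insert_erase hy
  refine ⟨T.erase l, (T.erase l).erase k, ⟨Finset.erase_subset _ _, hFc, Finset.erase_subset _ _,
    by rw [Finset.card_erase_of_mem hk, hFc]⟩, ?_⟩
  exact (convex_subTet _ _).segment_subset center_mem_subTet
    (convexHull_mono (Set.subset_insert _ _) hyk) hxy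

theorem affineSpan_eq_top_of_card (hT : T.card = 4)
    (hi : AffineIndependent ℝ ((↑) : T → E3)) : affineSpan ℝ (T : Set E3) = ⊤ := by
  have := (hi.affineSpan_eq_top_iff_card_eq_finrank_add_one).2 (by simp [hT])
  simpa using this

theorem IsFlag.exists_eq {F e : Finset E3} (h : IsFlag T F e) (hT : T.card = 4) [DecidableEq E3] :
    ∃ l ∈ T, ∃ k ∈ F, F = T.erase l ∧ e = F.erase k := by
  have h1 : (T \ F).card = 1 := by rw [Finset.card_sdiff_of_subset h.face_sub, hT, h.face_card]
  have h2 : (F \ e).card = 1 := by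
    rw [Finset.card_sdiff_of_subset h.edge_sub, h.face_card, h.edge_card]
  obtain ⟨l, hl⟩ := Finset.card_eq_one.1 h1
  obtain ⟨k, hk⟩ := Finset.card_eq_one.1 h2
  have hl' : l ∈ T \ F := by simp [hl]
  have hk' : k ∈ F \ e := by simp [hk]
  refine ⟨l, (Finset.mem_sdiff.1 hl').1, k, (Finset.mem_sdiff.1 hk').1, ?_, ?_⟩
  · rw [← Finset.sdiff_singleton_eq_erase, ← hl, Finset.sdiff_sdiff_eq_self h.face_sub]
  · rw [← Finset.sdiff_singleton_eq_erase, ← hk, Finset.sdiff_sdiff_eq_self h.edge_sub]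

/-- The four corners span the whole space: the vertex of `F` off `e` is recovered from `f F`, then
the vertex of `T` off `F` from `c T`. Nonempty interior is what makes derivatives within the
subtetrahedron unique. -/
theorem interior_subTet_nonempty (hT : T.card = 4) (hi : AffineIndependent ℝ ((↑) : T → E3))
    (hc : IsPosComb T (c T)) (hf : ∀ F ∈ T.powersetCard 3, IsPosComb F (f F)) {F e : Finset E3}
    (h : IsFlag T F e) : (interior (subTet c f T F e)).Nonempty := by
  classical
  rw [subTet, interior_convexHull_nonempty_iff_affineSpan_eq_top, eq_top_iff,
    ← affineSpan_eq_top_of_card hT hi]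
  obtain ⟨l, hl, k, hk, hF, he⟩ := h.exists_eq hT
  have hfF := hf F (Finset.mem_powersetCard.2 ⟨h.face_sub, h.face_card⟩)
  have hsub1 : (F : Set E3) ⊆ affineSpan ℝ (insert (f F) (e : Set E3)) := by
    intro x hx
    by_cases hxk : x = k
    · subst hxk
      rw [he]
      exact hfF.mem_affineSpan hk (by rw [h.face_card]; omega)
    · exact subset_affineSpan ℝ _ (by right; rw [he]; simp [hxk]; exact hx)
  have hsub2 : (F : Set E3) ⊆ affineSpan ℝ (insert (c T) (insert (f F) (e : Set E3))) :=
    hsub1.trans (affineSpan_mono ℝ (Set.subset_insert _ _))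
  refine affineSpan_le.2 fun x hx => ?_
  by_cases hxl : x = l
  · subst hxl
    have h1 := hc.mem_affineSpan hl (by rw [hT]; omega)
    rw [← hF] at h1
    refine affineSpan_le.2 ?_ h1
    exact Set.insert_subset (subset_affineSpan ℝ _ (by simp)) hsub2
  · refine hsub2 ?_
    rw [hF]
    simp [hxl]
    exact hx

end WF

namespace WF

/-! ### Stability of the Worsey-Farin interpolation -/

/-- The blossoms `b F e` of cubics on the subtetrahedra have the common first order contact data
`g`: here `g x` is the affine function `y ↦ w x + Dw x (y - x) / 3` for a `C¹` spline `w`. -/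
structure IsContact (c f : Finset E3 → E3) (T : Finset E3) (g : E3 → E3 → ℝ)
    (b : Finset E3 → Finset E3 → E3 → E3 → E3 →ᵃ[ℝ] ℝ) : Prop where
  blossom : ∀ F e, IsFlag T F e → ∃ q, IsBlossom (b F e) q
  contact : ∀ F e, IsFlag T F e → ∀ x ∈ subTet c f T F e, ∀ y, b F e x x y = g x y

variable {c f : Finset E3 → E3} {T : Finset E3} {g : E3 → E3 → ℝ}
  {b : Finset E3 → Finset E3 → E3 → E3 → E3 →ᵃ[ℝ] ℝ}

namespace IsContact

theorem swap (h : IsContact c f T g b) {F e : Finset E3} (hF : IsFlag T F e) (x y z : E3) :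
    b F e x y z = b F e y x z := by
  obtain ⟨q, hq⟩ := h.blossom F e hF
  exact hq.swap x y z

theorem swap' (h : IsContact c f T g b) {F e : Finset E3} (hF : IsFlag T F e) (x y z : E3) :
    b F e x y z = b F e x z y := by
  obtain ⟨q, hq⟩ := h.blossom F e hF
  exact hq.swap' x y z

theorem diag_mid (h : IsContact c f T g b) {F e : Finset E3} (hF : IsFlag T F e) (x y z : E3) :
    b F e (AffineMap.lineMap x y (1 / 2 : ℝ)) (AffineMap.lineMap x y (1 / 2 : ℝ)) z =
      1 / 4 * b F e x x z + 1 / 2 * b F e x y z + 1 / 4 * b F e y y z := by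
  obtain ⟨q, hq⟩ := h.blossom F e hF
  rw [hq.diag_lineMap]
  ring

/-- Blossoms of two subtetrahedra agree when two arguments are common points. -/
theorem agree (h : IsContact c f T g b) {F e F' e' : Finset E3} (hF : IsFlag T F e)
    (hF' : IsFlag T F' e') {a a' : E3} (ha : a ∈ subTet c f T F e) (ha' : a' ∈ subTet c f T F e)
    (hb : a ∈ subTet c f T F' e') (hb' : a' ∈ subTet c f T F' e') (y : E3) :
    b F e a a' y = b F' e' a a' y := by
  -- By convexity the midpoint of `a` and `a'` is common to both pieces as well. The contact data at
  -- `a`, `a'` and the midpoint determine the mixed value.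
  have h1 := h.diag_mid hF a a' y
  have h2 := h.diag_mid hF' a a' y
  have hm : (1 / 2 : ℝ) ∈ Set.Icc (0 : ℝ) 1 := by norm_num
  rw [h.contact F e hF _ ((convex_subTet F e).lineMap_mem ha ha' hm),
    h.contact F e hF a ha, h.contact F e hF a' ha'] at h1
  rw [h.contact F' e' hF' _ ((convex_subTet F' e').lineMap_mem hb hb' hm),
    h.contact F' e' hF' a hb, h.contact F' e' hF' a' hb'] at h2
  linarith

theorem agree_vertex_center (h : IsContact c f T g b) {F e F' e' : Finset E3} {i : E3}
    (hF : IsFlag T F e) (hF' : IsFlag T F' e') (hi : i ∈ e) (hi' : i ∈ e') (y : E3) :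
    b F e i (c T) y = b F' e' i (c T) y :=
  h.agree hF hF' (mem_subTet_of_mem_edge hi) center_mem_subTet (mem_subTet_of_mem_edge hi')
    center_mem_subTet y

theorem agree_center_center (h : IsContact c f T g b) {F e F' e' : Finset E3}
    (hF : IsFlag T F e) (hF' : IsFlag T F' e') (y : E3) :
    b F e (c T) (c T) y = b F' e' (c T) (c T) y :=
  h.agree hF hF' center_mem_subTet center_mem_subTet center_mem_subTet center_mem_subTet y

section Bounds

variable {M : ℝ}

/-- With `m` the midpoint of the edge, `b i j y = 2 * g m y - (g i y + g j y) / 2`, whence the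
factor `2 + 1/2 + 1/2 = 3`. -/
theorem abs_edge_le (h : IsContact c f T g b) (hM : ∀ i ∈ T, ∀ y ∈ hull T, |g i y| ≤ M)
    (hM' : ∀ i ∈ T, ∀ j ∈ T, i ≠ j → ∀ y ∈ hull T,
      |g (AffineMap.lineMap i j (1 / 2 : ℝ)) y| ≤ M) {F e : Finset E3}
    (hF : IsFlag T F e) {i j y : E3} (hi : i ∈ e) (hj : j ∈ e) (hy : y ∈ hull T) :
    |b F e i j y| ≤ 3 * M := by
  have hiT := hF.face_sub (hF.edge_sub hi)
  have hjT := hF.face_sub (hF.edge_sub hj)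
  have h1 := hM i hiT y hy
  have h2 := hM j hjT y hy
  by_cases hij : i = j
  · subst hij
    rw [h.contact F e hF i (mem_subTet_of_mem_edge hi)]
    linarith [abs_nonneg (g i y)]
  · have h3 := h.diag_mid hF i j y
    have hm : (1 / 2 : ℝ) ∈ Set.Icc (0 : ℝ) 1 := by norm_num
    rw [h.contact F e hF _ ((convex_subTet F e).lineMap_mem (mem_subTet_of_mem_edge hi)
      (mem_subTet_of_mem_edge hj) hm), h.contact F e hF i (mem_subTet_of_mem_edge hi),
      h.contact F e hF j (mem_subTet_of_mem_edge hj)] at h3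
    have h4 := abs_le.1 (hM' i hiT j hjT hij y hy)
    have h1 := abs_le.1 h1
    have h2 := abs_le.1 h2
    rw [abs_le]
    constructor <;> linarith [h1.1, h1.2, h2.1, h2.2, h4.1, h4.2]

/-- All the Bézier coefficients of the subtetrahedra are bounded by those on the edges. -/
theorem abs_control_le (h : IsContact c f T g b) (hT : T.card = 4) (hc : IsPosComb T (c T))
    (hf : ∀ F ∈ T.powersetCard 3, IsPosComb F (f F))
    (hM : ∀ F e, IsFlag T F e → ∀ i ∈ e, ∀ j ∈ e, ∀ y ∈ hull T, |b F e i j y| ≤ M)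
    {F e : Finset E3} (hF : IsFlag T F e) {a a' a'' : E3}
    (ha : a ∈ insert (c T) (insert (f F) (e : Set E3)))
    (ha' : a' ∈ insert (c T) (insert (f F) (e : Set E3)))
    (ha'' : a'' ∈ insert (c T) (insert (f F) (e : Set E3))) : |b F e a a' a''| ≤ M := by
  have hcT := hc.mem_hull
  have hfF : f F ∈ hull F := (hf F (Finset.mem_powersetCard.2 ⟨hF.face_sub, hF.face_card⟩)).mem_hull
  have hfT : f F ∈ hull T := hull_mono hF.face_sub hfF
  have hTe : ∀ {i}, i ∈ e → i ∈ T := fun hi => hF.face_sub (hF.edge_sub hi)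
  -- The last argument is reduced to a vertex `j` by affinity. Since `i` and `c T` are shared by all
  -- pieces at `i`, one may pass to a piece with `i`, `j` on its edge, and there the value is an
  -- edge value with `c T` as free argument.
  have hic : ∀ {F e}, IsFlag T F e → ∀ {i}, i ∈ e → ∀ y ∈ hull T, |b F e i (c T) y| ≤ M := by
    intro F e hF i hi y hy
    refine abs_affine_le_of_mem_convexHull _ (fun j hj => ?_) hy
    obtain ⟨F', e', hF', hi', hj'⟩ := exists_isFlag hT (hF.face_sub (hF.edge_sub hi)) hj
    rw [h.agree_vertex_center hF hF' hi hi', h.swap' hF']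
    exact hM F' e' hF' i hi' j hj' _ hcT
  have hcc : ∀ y ∈ hull T, |b F e (c T) (c T) y| ≤ M := by
    intro y hy
    refine abs_affine_le_of_mem_convexHull _ (fun j hj => ?_) hy
    obtain ⟨F', e', hF', hj', -⟩ := exists_isFlag hT hj hj
    rw [h.agree_center_center hF hF', h.swap' hF', h.swap hF', h.swap' hF', h.swap' hF']
    exact hic hF' hj' _ hcT
  -- The point `f F` belongs to the pieces over `F`, so the change of piece stays over this face and
  -- the free argument is restricted to `F`.
  have hif : ∀ {e}, IsFlag T F e → ∀ {i}, i ∈ e → ∀ y ∈ hull F, |b F e i (f F) y| ≤ M := by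
    intro e hF i hi y hy
    refine abs_affine_le_of_mem_convexHull _ (fun j hj => ?_) hy
    obtain ⟨e', hF', hi', hj'⟩ := hF.exists_edge (hF.edge_sub hi) hj
    rw [h.agree hF hF' (mem_subTet_of_mem_edge hi) faceCenter_mem_subTet
      (mem_subTet_of_mem_edge hi') faceCenter_mem_subTet, h.swap' hF']
    exact hM F e' hF' i hi' j hj' _ hfT
  have hff : ∀ y ∈ hull F, |b F e (f F) (f F) y| ≤ M := by
    intro y hy
    refine abs_affine_le_of_mem_convexHull _ (fun j hj => ?_) hy
    obtain ⟨e', hF', hj', -⟩ := hF.exists_edge hj hj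
    rw [h.agree hF hF' faceCenter_mem_subTet faceCenter_mem_subTet faceCenter_mem_subTet
      faceCenter_mem_subTet, h.swap' hF', h.swap hF']
    exact hif hF' hj' _ hfF
  have hcf : ∀ y ∈ hull F, |b F e (c T) (f F) y| ≤ M := by
    intro y hy
    refine abs_affine_le_of_mem_convexHull _ (fun j hj => ?_) hy
    obtain ⟨e', hF', hj', -⟩ := hF.exists_edge hj hj
    rw [h.agree hF hF' center_mem_subTet faceCenter_mem_subTet center_mem_subTet
      faceCenter_mem_subTet, h.swap' hF', h.swap hF']
    exact hic hF' hj' _ hfT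
  have hmem : ∀ {z}, z ∈ insert (c T) (insert (f F) (e : Set E3)) → z ∈ hull T := by
    rintro z (rfl | rfl | hz)
    exacts [hcT, hfT, mem_hull (hTe hz)]
  have hmemF : ∀ {z}, z ∈ insert (f F) (e : Set E3) → z ∈ hull F := by
    rintro z (rfl | hz)
    exacts [hfF, mem_hull (hF.edge_sub hz)]
  -- If the last argument is the incenter, the arguments are permuted so that it becomes one of the
  -- two common points; otherwise the last argument lies in `F`.
  have hif' : ∀ {i}, i ∈ e → |b F e i (f F) a''| ≤ M := by
    intro i hi
    rcases ha'' with rfl | ha''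
    · rw [h.swap' hF]
      exact hic hF hi _ hfT
    · exact hif hF hi _ (hmemF ha'')
  have hff' : |b F e (f F) (f F) a''| ≤ M := by
    rcases ha'' with rfl | ha''
    · rw [h.swap' hF, h.swap hF]
      exact hcf _ hfF
    · exact hff _ (hmemF ha'')
  have hcf' : |b F e (c T) (f F) a''| ≤ M := by
    rcases ha'' with rfl | ha''
    · rw [h.swap' hF]
      exact hcc _ hfT
    · exact hcf _ (hmemF ha'')
  rcases ha with rfl | rfl | ha <;> rcases ha' with rfl | rfl | ha'
  · exact hcc _ (hmem ha'')
  · exact hcf'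
  · rw [h.swap hF]
    exact hic hF ha' _ (hmem ha'')
  · rw [h.swap hF]
    exact hcf'
  · exact hff'
  · rw [h.swap hF]
    exact hif' ha'
  · exact hic hF ha _ (hmem ha'')
  · exact hif' ha
  · exact hM F e hF _ ha _ ha' _ (hmem ha'')

/-- A `C¹` cubic Worsey-Farin spline is bounded by its contact data at vertices and edge
midpoints. -/
theorem abs_diag_le (h : IsContact c f T g b) (hT : T.card = 4) (hc : IsPosComb T (c T))
    (hf : ∀ F ∈ T.powersetCard 3, IsPosComb F (f F))
    (hM : ∀ i ∈ T, ∀ y ∈ hull T, |g i y| ≤ M)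
    (hM' : ∀ i ∈ T, ∀ j ∈ T, i ≠ j → ∀ y ∈ hull T,
      |g (AffineMap.lineMap i j (1 / 2 : ℝ)) y| ≤ M) {x : E3} (hx : x ∈ hull T) :
    |g x x| ≤ 3 * M := by
  obtain ⟨F, e, hF, hxF⟩ := exists_mem_subTet hT hc hf hx
  rw [← h.contact F e hF x hxF]
  -- The three arguments are moved to corners of the subtetrahedron one at a time: a Bernstein
  -- polynomial is bounded by its control values.
  refine abs_affine_le_of_mem_convexHull _ (fun a ha => ?_) hxF
  rw [h.swap' hF]
  refine abs_affine_le_of_mem_convexHull _ (fun a' ha' => ?_) hxF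
  rw [h.swap' hF, h.swap hF, h.swap' hF]
  refine abs_affine_le_of_mem_convexHull _ (fun a'' ha'' => ?_) hxF
  exact h.abs_control_le hT hc hf
    (fun F e hF i hi j hj y hy => h.abs_edge_le hM hM' hF hi hj hy) hF ha' ha ha''

end Bounds

end IsContact

/-! ### Contact data and degrees of freedom of Worsey-Farin splines -/

/-- The contact data of a function on a tetrahedron. -/
noncomputable def contactData (T : Finset E3) (w : E3 → ℝ) (x y : E3) : ℝ :=
  w x + fderivWithin ℝ w (hull T) x (y - x) / 3

/-- The derivative of `w` within `T` restricts to the unique derivative within each subtetrahedron,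
which is that of the polynomial piece. So pieces meeting at a point have the same value and gradient
there. -/
theorem MemWF.exists_isContact {w : E3 → ℝ} (hw : MemWF c f T w) (hT : T.card = 4)
    (hi : AffineIndependent ℝ ((↑) : T → E3)) (hc : IsPosComb T (c T))
    (hf : ∀ F ∈ T.powersetCard 3, IsPosComb F (f F)) :
    ∃ b, IsContact c f T (contactData T w) b := by
  have hP : ∀ F e, ∃ b, IsFlag T F e → (∃ q, IsBlossom b q) ∧
      ∀ x ∈ subTet c f T F e, ∀ y, b x x y = contactData T w x y := by
    intro F e
    by_cases hF : IsFlag T F e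
    · obtain ⟨P, hPd, hPw⟩ := hw.2 F (Finset.mem_powersetCard.2 ⟨hF.face_sub, hF.face_card⟩) e
        (Finset.mem_powersetCard.2 ⟨hF.edge_sub, hF.edge_card⟩)
      obtain ⟨b, hb⟩ := exists_isBlossom_polyFun P hPd
      refine ⟨b, fun _ => ⟨⟨_, hb⟩, fun x hx y => ?_⟩⟩
      have hu : UniqueDiffWithinAt ℝ (subTet c f T F e) x :=
        uniqueDiffOn_convex (convex_subTet F e) (interior_subTet_nonempty hT hi hc hf hF) x hx
      have hsub := subTet_subset_hull hc hf hF
      have h1 : fderivWithin ℝ w (subTet c f T F e) x = fderivWithin ℝ w (hull T) x :=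
        fderivWithin_subset hsub hu
          ((hw.1.differentiableOn (by simp)) x (hsub hx))
      have h2 : fderivWithin ℝ w (subTet c f T F e) x = fderiv ℝ (polyFun P) x := by
        rw [← fderivWithin_eq_fderiv hu (differentiable_polyFun P x)]
        exact fderivWithin_congr hPw (hPw x hx)
      rw [contactData, ← h1, h2, hPw x hx, hb.fderiv_apply (differentiable_polyFun P x)]
      simp
    · exact ⟨0, fun h => absurd h hF⟩
  choose b hb using hP
  exact ⟨b, fun F e hF => (hb F e hF).1, fun F e hF => (hb F e hF).2⟩

theorem totalDegree_sub_le {P Q : MvPolynomial (Fin 3) ℝ} {n : ℕ} (hP : P.totalDegree ≤ n)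
    (hQ : Q.totalDegree ≤ n) : (P - Q).totalDegree ≤ n :=
  (MvPolynomial.totalDegree_sub P Q).trans (max_le hP hQ)

theorem polyFun_sub (P Q : MvPolynomial (Fin 3) ℝ) (x : E3) :
    polyFun (P - Q) x = polyFun P x - polyFun Q x := by
  simp [polyFun]

theorem contDiff_polyFun (P : MvPolynomial (Fin 3) ℝ) : ContDiff ℝ 1 (polyFun P) := by
  have : polyFun P = fun x => ∑ s ∈ P.support, P.coeff s * ∏ i, x i ^ s i := by
    funext x
    simp [polyFun, MvPolynomial.eval_eq']
  rw [this]
  fun_prop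

/-- Degree at most 3 enters here: the error of the smoothing operator lies in the local spline
space. -/
theorem MemWF.polyFun_sub {w : E3 → ℝ} (hw : MemWF c f T w) {P : MvPolynomial (Fin 3) ℝ}
    (hP : P.totalDegree ≤ 3) : MemWF c f T (fun x => polyFun P x - w x) := by
  refine ⟨(contDiff_polyFun P).contDiffOn.sub hw.1, fun F hF e he => ?_⟩
  obtain ⟨Q, hQ, hQw⟩ := hw.2 F hF e he
  exact ⟨P - Q, totalDegree_sub_le hP hQ, fun x hx => by
    simp only [WF.polyFun_sub, hQw x hx]⟩

/-- An orthonormal pair orthogonal to a vector `d ≠ 0` controls a linear form together with `d`. -/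
theorem abs_apply_le_of_frame (L : E3 →L[ℝ] ℝ) {ν : Fin 2 → E3} (hν : Orthonormal ℝ ν) {d : E3}
    (hd : d ≠ 0) (hperp : ∀ i, inner ℝ (ν i) d = 0) (y : E3) :
    |L y| ≤ ‖y‖ * (|L d| / ‖d‖ + |L (ν 0)| + |L (ν 1)|) := by
  have hd' : ‖d‖ ≠ 0 := norm_ne_zero_iff.2 hd
  have hon : Orthonormal ℝ ![‖d‖⁻¹ • d, ν 0, ν 1] := by
    have h1 := hν.1
    have h2 := hν.2
    have h01 : inner ℝ (ν 0) (ν 1) = 0 := h2 (by decide)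
    have h10 : inner ℝ (ν 1) (ν 0) = 0 := h2 (by decide)
    have hp' : ∀ i, inner ℝ d (ν i) = 0 := fun i => by rw [real_inner_comm, hperp]
    refine ⟨fun i => ?_, fun i j hij => ?_⟩
    · fin_cases i
      · simp [norm_smul, hd']
      · exact h1 0
      · exact h1 1
    · fin_cases i <;> fin_cases j <;>
        simp_all [inner_smul_left, inner_smul_right]
  let B := OrthonormalBasis.mk hon (by
    rw [top_le_iff]
    exact hon.linearIndependent.span_eq_top_of_card_eq_finrank (by simp))
  have hB : (B : Fin 3 → E3) = ![‖d‖⁻¹ • d, ν 0, ν 1] := OrthonormalBasis.coe_mk _ _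
  have hy := B.sum_repr' y
  have hle : ∀ i, |inner ℝ (B i) y * L (B i)| ≤ ‖y‖ * |L (B i)| := fun i => by
    rw [abs_mul]
    refine mul_le_mul_of_nonneg_right ?_ (abs_nonneg _)
    have := abs_real_inner_le_norm (B i) y
    rwa [B.orthonormal.1 i, one_mul] at this
  have hL : L y = ∑ i, inner ℝ (B i) y * L (B i) := by
    conv_lhs => rw [← hy]
    simp [map_sum]
  have h3 : L (‖d‖⁻¹ • d) = L d / ‖d‖ := by simp [div_eq_inv_mul]
  calc |L y| ≤ ∑ i, |inner ℝ (B i) y * L (B i)| := by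
        rw [hL]
        exact Finset.abs_sum_le_sum_abs _ _
    _ ≤ ∑ i, ‖y‖ * |L (B i)| := Finset.sum_le_sum fun i _ => hle i
    _ = ‖y‖ * (|L d| / ‖d‖ + |L (ν 0)| + |L (ν 1)|) := by
        rw [← Finset.mul_sum, hB, Fin.sum_univ_three]
        simp [abs_mul, div_eq_inv_mul]

/-- Stability of the Worsey-Farin element: a spline is bounded by its values and gradients at the
vertices and its normal derivatives at the edge midpoints. -/
theorem MemWF.abs_le_of_dofs {w : E3 → ℝ} (hw : MemWF c f T w) (hT : T.card = 4)
    (hi : AffineIndependent ℝ ((↑) : T → E3)) (hc : IsPosComb T (c T))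
    (hf : ∀ F ∈ T.powersetCard 3, IsPosComb F (f F)) {M h κ : ℝ} (hκ : 0 ≤ κ)
    (hdiam : ∀ x ∈ hull T, ∀ y ∈ hull T, ‖x - y‖ ≤ h)
    (hedge : ∀ i ∈ T, ∀ j ∈ T, i ≠ j → h ≤ κ * ‖j - i‖)
    (hval : ∀ i ∈ T, |w i| ≤ M) (hgrad : ∀ i ∈ T, h * ‖fderivWithin ℝ w (hull T) i‖ ≤ M)
    (hnormal : ∀ i ∈ T, ∀ j ∈ T, i ≠ j → ∃ ν : Fin 2 → E3, Orthonormal ℝ ν ∧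
      (∀ l, inner ℝ (ν l) (j - i) = 0) ∧ ∀ l,
        h * |fderivWithin ℝ w (hull T) (AffineMap.lineMap i j (1 / 2 : ℝ)) (ν l)| ≤ M)
    {x : E3} (hx : x ∈ hull T) : |w x| ≤ (6 + 4 * κ) * M := by
  obtain ⟨b, hb⟩ := hw.exists_isContact hT hi hc hf
  have hM0 : 0 ≤ M := by
    obtain ⟨i, hi⟩ := Finset.card_pos.1 (by rw [hT]; norm_num : 0 < T.card)
    exact (abs_nonneg _).trans (hval i hi)
  have hv : ∀ i ∈ T, ∀ y ∈ hull T, |contactData T w i y| ≤ 4 / 3 * M := by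
    intro i hi y hy
    have h1 : |fderivWithin ℝ w (hull T) i (y - i)| ≤ M := by
      refine ((fderivWithin ℝ w (hull T) i).le_opNorm (y - i)).trans ?_
      rw [mul_comm]
      exact (mul_le_mul_of_nonneg_right (hdiam y hy i (mem_hull hi)) (norm_nonneg _)).trans
        (hgrad i hi)
    rw [contactData]
    refine (abs_add_le _ _).trans ?_
    rw [abs_div, abs_of_pos (by norm_num : (0 : ℝ) < 3)]
    linarith [hval i hi]
  have hm : ∀ i ∈ T, ∀ j ∈ T, i ≠ j → ∀ y ∈ hull T,
      |contactData T w (AffineMap.lineMap i j (1 / 2 : ℝ)) y| ≤ (2 + 4 / 3 * κ) * M := by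
    intro i hiT j hjT hij y hy
    obtain ⟨ν, hν, hperp, hνM⟩ := hnormal i hiT j hjT hij
    obtain ⟨F, e, hF, hie, hje⟩ := exists_isFlag hT hiT hjT
    obtain ⟨q, hq⟩ := hb.blossom F e hF
    set m := AffineMap.lineMap i j (1 / 2 : ℝ) with hmdef
    have hmem : m ∈ subTet c f T F e := (convex_subTet F e).lineMap_mem
      (mem_subTet_of_mem_edge hie) (mem_subTet_of_mem_edge hje) (by norm_num)
    have hmT := subTet_subset_hull hc hf hF hmem
    have hcon : ∀ z, b F e m m z = w m + fderivWithin ℝ w (hull T) m (z - m) / 3 :=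
      fun z => hb.contact F e hF m hmem z
    have hii := hb.contact F e hF i (mem_subTet_of_mem_edge hie)
    have hjj := hb.contact F e hF j (mem_subTet_of_mem_edge hje)
    have e1 := abs_le.1 (hv i hiT i (mem_hull hiT))
    have e2 := abs_le.1 (hv i hiT j (mem_hull hjT))
    have e3 := abs_le.1 (hv j hjT i (mem_hull hiT))
    have e4 := abs_le.1 (hv j hjT j (mem_hull hjT))
    rw [← hii] at e1 e2
    rw [← hjj] at e3 e4
    have hmi := hb.diag_mid hF i j i
    have hmj := hb.diag_mid hF i j j
    rw [← hmdef, hb.swap' hF i j i] at hmi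
    rw [← hmdef, ← hb.swap hF j i j, hb.swap' hF j i j] at hmj
    -- On the edge the four Bernstein coefficients are contact data of the two end points, so the
    -- value at the midpoint is a convex combination of them.
    have hwm : |w m| ≤ 4 / 3 * M := by
      have h1 : w m = b F e m m m := by rw [hcon]; simp
      have h2 : b F e m m m = 1 / 2 * b F e m m i + 1 / 2 * b F e m m j := by
        have := hq.line_right m m i j (1 / 2)
        rw [← hmdef] at this
        rw [this]
        ring
      rw [h1, h2, abs_le]
      constructor <;> linarith [e1.1, e1.2, e2.1, e2.2, e3.1, e3.2, e4.1, e4.2]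
    -- The derivative along the edge is not prescribed at the midpoint. It follows from the end
    -- points as `3/4` of a signed sum of the four coefficients, each at most `4/3 * M`.
    have htan : |fderivWithin ℝ w (hull T) m (j - i)| ≤ 4 * M := by
      have h1 : fderivWithin ℝ w (hull T) m (j - i) = 3 * (b F e m m j - b F e m m i) := by
        rw [hcon, hcon, ← sub_sub_sub_cancel_right j i m, map_sub]
        ring
      rw [h1, abs_le]
      constructor <;> linarith [e1.1, e1.2, e2.1, e2.2, e3.1, e3.2, e4.1, e4.2]
    have hd : 0 < ‖j - i‖ := norm_pos_iff.2 (sub_ne_zero.2 hij.symm)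
    have hD := abs_apply_le_of_frame (fderivWithin ℝ w (hull T) m) hν
      (sub_ne_zero.2 hij.symm) hperp (y - m)
    have htan' : h * (|fderivWithin ℝ w (hull T) m (j - i)| / ‖j - i‖) ≤ κ * (4 * M) := by
      rw [mul_div_assoc', div_le_iff₀ hd]
      calc h * |fderivWithin ℝ w (hull T) m (j - i)| ≤ (κ * ‖j - i‖) * (4 * M) :=
            mul_le_mul (hedge i hiT j hjT hij) htan (abs_nonneg _) (by positivity)
        _ = κ * (4 * M) * ‖j - i‖ := by ring
    have hD' : |fderivWithin ℝ w (hull T) m (y - m)| ≤ κ * (4 * M) + M + M := by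
      refine hD.trans ((mul_le_mul_of_nonneg_right (hdiam y hy m hmT) (by positivity)).trans ?_)
      rw [mul_add, mul_add]
      linarith [hνM 0, hνM 1]
    rw [contactData]
    refine (abs_add_le _ _).trans ?_
    rw [abs_div, abs_of_pos (by norm_num : (0 : ℝ) < 3)]
    linarith
  -- The midpoint bound dominates the vertex bound `4/3 * M`, and `3 * (2 + 4/3 * κ) = 6 + 4 * κ`.
  have key := hb.abs_diag_le hT hc hf (M := (2 + 4 / 3 * κ) * M)
    (fun i hi y hy => (hv i hi y hy).trans (by nlinarith [mul_nonneg hκ hM0])) hm hx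
  simp only [contactData, sub_self, map_zero, zero_div, add_zero] at key
  linarith

end WF

namespace WF

/-! ### Shape regular simplices -/

/-- Barycentric coordinates of a tetrahedron containing a ball of radius `r` have Lipschitz constant
at most `1 / (2 r)`. -/
theorem exists_barycentric {T : Finset E3} (hT : T.card = 4)
    (hi : AffineIndependent ℝ ((↑) : T → E3)) {x : E3} {r : ℝ} (hr : 0 < r)
    (hball : Metric.closedBall x r ⊆ hull T) {i : E3} (hiT : i ∈ T) :
    ∃ A : E3 →ᵃ[ℝ] ℝ, A i = 1 ∧ (∀ j ∈ T, j ≠ i → A j = 0) ∧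
      ∀ y z, A y - A z ≤ ‖y - z‖ / (2 * r) := by
  let B : AffineBasis T ℝ E3 := ⟨(↑), hi, by simpa using affineSpan_eq_top_of_card hT hi⟩
  have hB : ∀ j : T, B j = (j : E3) := fun j => rfl
  set A := B.coord ⟨i, hiT⟩ with hA
  have h1 : A i = 1 := by
    have := B.coord_apply_eq ⟨i, hiT⟩
    rwa [hB] at this
  have h0 : ∀ j ∈ T, j ≠ i → A j = 0 := by
    intro j hj hji
    have := B.coord_apply_ne (i := ⟨i, hiT⟩) (j := ⟨j, hj⟩) (by simpa using hji.symm)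
    rwa [hB] at this
  have h01 : ∀ y ∈ hull T, A y ∈ Set.Icc (0 : ℝ) 1 := by
    intro y hy
    refine convexHull_min (fun j hj => ?_) ((convex_Icc (0 : ℝ) 1).affine_preimage A) hy
    by_cases hji : j = i
    · simp [hji, h1]
    · simp [h0 j hj hji]
  refine ⟨A, h1, h0, fun y z => ?_⟩
  rcases eq_or_ne y z with rfl | hyz
  · simp
  have hn : 0 < ‖y - z‖ := norm_pos_iff.2 (sub_ne_zero.2 hyz)
  -- The points `x ± u` are the ends of a diameter of the ball parallel to `y - z`. There the
  -- coordinate lies in `[0, 1]`, so it changes by at most 1 over the length `2 * r`.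
  set u := (r / ‖y - z‖) • (y - z) with hu
  have hun : ‖u‖ = r := by
    rw [hu, norm_smul, Real.norm_of_nonneg (by positivity), div_mul_cancel₀ _ hn.ne']
  have hx1 := h01 _ (hball (by simp [hun] : x + u ∈ Metric.closedBall x r))
  have hx2 := h01 _ (hball (by simp [hun] : x - u ∈ Metric.closedBall x r))
  have e1 : A (x + u) - A (x - u) = A.linear (2 • u) := by
    rw [← vsub_eq_sub, ← A.linearMap_vsub]
    congr 1
    simp only [vsub_eq_sub]
    module
  have e2 : A y - A z = A.linear (y - z) := by
    rw [← vsub_eq_sub, ← A.linearMap_vsub]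
    rfl
  have e3 : A.linear (2 • u) = 2 * (r / ‖y - z‖) * A.linear (y - z) := by
    simp [hu]
    ring
  rw [le_div_iff₀ (by positivity), e2]
  have h4 : 2 * (r / ‖y - z‖) * A.linear (y - z) ≤ 1 := by
    rw [← e3, ← e1]
    linarith [hx1.2, hx2.1]
  have h5 : 2 * (r / ‖y - z‖) * A.linear (y - z) = A.linear (y - z) * (2 * r) / ‖y - z‖ := by
    ring
  rwa [h5, div_le_one hn] at h4

/-- The barycentric coordinate of `i` falls from 1 to 0 along the edge and has Lipschitz constant `1
/ (2 * r)`. -/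
theorem two_mul_radius_le_norm_sub {T : Finset E3} (hT : T.card = 4)
    (hi : AffineIndependent ℝ ((↑) : T → E3)) {x : E3} {r : ℝ} (hr : 0 < r)
    (hball : Metric.closedBall x r ⊆ hull T) {i j : E3} (hiT : i ∈ T) (hjT : j ∈ T) (hij : i ≠ j) :
    2 * r ≤ ‖i - j‖ := by
  obtain ⟨A, h1, h0, hA⟩ := exists_barycentric hT hi hr hball hiT
  have := hA i j
  rwa [h1, h0 j hjT hij.symm, sub_zero, le_div_iff₀ (by positivity), one_mul] at this

/-! ### Triangles: parametrization, area and inverse estimate -/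

/-- The reference triangle. -/
def refTriangle : Set (EuclideanSpace ℝ (Fin 2)) := {p | 0 ≤ p 0 ∧ 0 ≤ p 1 ∧ p 0 + p 1 ≤ 1}

theorem volume_refTriangle_pos : 0 < volume refTriangle := by
  have ho : IsOpen {p : EuclideanSpace ℝ (Fin 2) | 0 < p 0 ∧ 0 < p 1 ∧ p 0 + p 1 < 1} := by
    have h0 (l : Fin 2) : Continuous fun p : EuclideanSpace ℝ (Fin 2) => p l := by fun_prop
    exact (isOpen_lt continuous_const (h0 0)).inter ((isOpen_lt continuous_const (h0 1)).inter
      (isOpen_lt ((h0 0).add (h0 1)) continuous_const))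
  refine (ho.measure_pos volume ⟨!₂[1 / 4, 1 / 4], ?_⟩).trans_le (measure_mono ?_)
  · norm_num
  · rintro p ⟨h1, h2, h3⟩
    exact ⟨h1.le, h2.le, h3.le⟩

theorem volume_refTriangle_lt_top : volume refTriangle < ⊤ := by
  refine Bornology.IsBounded.measure_lt_top ?_
  refine Metric.isBounded_closedBall.subset (t := Metric.closedBall 0 2) fun p hp => ?_
  obtain ⟨h1, h2, h3⟩ := hp
  rw [mem_closedBall_zero_iff, EuclideanSpace.norm_eq, Fin.sum_univ_two]
  refine Real.sqrt_le_iff.2 ⟨by norm_num, ?_⟩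
  simp only [Real.norm_eq_abs, sq_abs]
  nlinarith

theorem convex_refTriangle : Convex ℝ refTriangle := by
  rintro p ⟨h1, h2, h3⟩ q ⟨h4, h5, h6⟩ s t hs ht hst
  refine ⟨?_, ?_, ?_⟩ <;> simp only [PiLp.add_apply, PiLp.smul_apply, smul_eq_mul]
  · positivity
  · positivity
  · nlinarith

/-- The affine parametrization of the plane of a triangle. -/
noncomputable def planeMap (i j k : E3) (p : EuclideanSpace ℝ (Fin 2)) : E3 :=
  i + p 0 • (j - i) + p 1 • (k - i)

theorem planeMap_image_refTriangle (i j k : E3) :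
    planeMap i j k '' refTriangle = convexHull ℝ {i, j, k} := by
  refine Set.Subset.antisymm ?_ (convexHull_min ?_ ?_)
  · rintro _ ⟨p, ⟨h1, h2, h3⟩, rfl⟩
    have hc := convex_convexHull ℝ ({i, j, k} : Set E3)
    have := hc.sum_mem (t := Finset.univ) (w := ![1 - p 0 - p 1, p 0, p 1]) (z := ![i, j, k])
      (fun l _ => by fin_cases l <;> simp <;> linarith)
      (by simp [Fin.sum_univ_three]; ring) (fun l _ => subset_convexHull ℝ _ (by fin_cases l <;> simp))
    convert! this using 1
    simp only [planeMap, Fin.sum_univ_three, Matrix.cons_val_zero, Matrix.cons_val_one,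
      Matrix.cons_val]
    module
  · rintro _ (rfl | rfl | rfl)
    · exact ⟨0, by simp [refTriangle], by simp [planeMap]⟩
    · exact ⟨!₂[1, 0], by simp [refTriangle], by simp [planeMap]⟩
    · exact ⟨!₂[0, 1], by simp [refTriangle], by simp [planeMap]⟩
  · rintro _ ⟨p, hp, rfl⟩ _ ⟨q, hq, rfl⟩ s t hs ht hst
    refine ⟨s • p + t • q, convex_refTriangle hp hq hs ht hst, ?_⟩
    obtain rfl : s = 1 - t := by linarith
    simp only [planeMap, PiLp.add_apply, PiLp.smul_apply, smul_eq_mul]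
    module

theorem lipschitzWith_planeMap (i j k : E3) :
    LipschitzWith (‖j - i‖₊ + ‖k - i‖₊) (planeMap i j k) := by
  refine LipschitzWith.of_dist_le_mul fun p q => ?_
  have h : planeMap i j k p - planeMap i j k q =
      (p - q) 0 • (j - i) + (p - q) 1 • (k - i) := by
    simp only [planeMap, PiLp.sub_apply]
    module
  rw [dist_eq_norm, h, dist_eq_norm, NNReal.coe_add, add_mul]
  refine (norm_add_le _ _).trans (add_le_add ?_ ?_) <;>
  · rw [norm_smul, mul_comm]
    exact mul_le_mul_of_nonneg_left (PiLp.norm_apply_le _ _) (norm_nonneg _)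

/-- The barycentric coordinates of `j` and `k` read the parameters off the image point. Each has
Lipschitz constant `1 / (2 * r)`, and the two add up to `1 / r`. -/
theorem antilipschitzWith_planeMap {i j k : E3} {r : NNReal} (hr : 0 < r) {A A' : E3 →ᵃ[ℝ] ℝ}
    (hA : ∀ y z, A y - A z ≤ ‖y - z‖ / (2 * r)) (hA' : ∀ y z, A' y - A' z ≤ ‖y - z‖ / (2 * r))
    (hi : A i = 0) (hj : A j = 1) (hk : A k = 0) (hi' : A' i = 0) (hj' : A' j = 0)
    (hk' : A' k = 1) : AntilipschitzWith r⁻¹ (planeMap i j k) := by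
  have happ : ∀ (L : E3 →ᵃ[ℝ] ℝ) (p : EuclideanSpace ℝ (Fin 2)),
      L (planeMap i j k p) = L i + p 0 * (L j - L i) + p 1 * (L k - L i) := by
    intro L p
    have h1 := L.map_vadd i (p 0 • (j - i) + p 1 • (k - i))
    rw [map_add, map_smul, map_smul, ← vsub_eq_sub, ← vsub_eq_sub, L.linearMap_vsub,
      L.linearMap_vsub] at h1
    simp only [vadd_eq_add, vsub_eq_sub, smul_eq_mul] at h1
    rw [planeMap, add_assoc, add_comm, h1]
    ring
  refine AntilipschitzWith.of_le_mul_dist fun p q => ?_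
  have hA1 : |p 0 - q 0| ≤ ‖planeMap i j k p - planeMap i j k q‖ / (2 * r) := by
    have h1 := hA (planeMap i j k p) (planeMap i j k q)
    have h2 := hA (planeMap i j k q) (planeMap i j k p)
    rw [norm_sub_rev] at h2
    simp only [happ, hi, hj, hk] at h1 h2
    rw [abs_le]
    constructor <;> linarith
  have hA2 : |p 1 - q 1| ≤ ‖planeMap i j k p - planeMap i j k q‖ / (2 * r) := by
    have h1 := hA' (planeMap i j k p) (planeMap i j k q)
    have h2 := hA' (planeMap i j k q) (planeMap i j k p)
    rw [norm_sub_rev] at h2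
    simp only [happ, hi', hj', hk'] at h1 h2
    rw [abs_le]
    constructor <;> linarith
  have hle : ‖p - q‖ ≤ |p 0 - q 0| + |p 1 - q 1| := by
    rw [EuclideanSpace.norm_eq, Fin.sum_univ_two]
    refine Real.sqrt_le_iff.2 ⟨by positivity, ?_⟩
    simp only [Real.norm_eq_abs, PiLp.sub_apply]
    nlinarith [abs_nonneg (p 0 - q 0), abs_nonneg (p 1 - q 1)]
  rw [dist_eq_norm, dist_eq_norm]
  have hr' : (0 : ℝ) < r := hr
  calc ‖p - q‖ ≤ _ := hle.trans (add_le_add hA1 hA2)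
    _ = _ := by
      push_cast
      field_simp
      ring

theorem euclideanHausdorffMeasure_hull_lt_top {F : Finset E3} (hF : F.card = 3) :
    Measure.euclideanHausdorffMeasure 2 (hull F) < ⊤ := by
  classical
  obtain ⟨i, j, k, -, -, -, rfl⟩ := Finset.card_eq_three.1 hF
  have h1 : hull {i, j, k} = planeMap i j k '' refTriangle := by
    rw [planeMap_image_refTriangle]
    simp [hull]
  have h2 := (lipschitzWith_planeMap i j k).hausdorffMeasure_image_le (d := (2 : ℕ)) (by simp)
    refTriangle
  have h3 : μH[(2 : ℕ)] refTriangle < ⊤ := by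
    have := volume_refTriangle_lt_top
    rw [← EuclideanSpace.euclideanHausdorffMeasure_eq_volume,
      Measure.euclideanHausdorffMeasure_def, Measure.smul_apply] at this
    by_contra hcon
    rw [not_lt_top_iff.1 hcon, ENNReal.smul_def, smul_eq_mul, ENNReal.mul_top] at this
    · exact lt_irrefl _ this
    · simpa using Measure.addHaarScalarFactor_volume_hausdorffMeasure_ne_zero 2
  rw [h1, Measure.euclideanHausdorffMeasure_def, Measure.smul_apply, ENNReal.smul_def, smul_eq_mul]
  refine ENNReal.mul_lt_top (by simp) (h2.trans_lt (ENNReal.mul_lt_top ?_ h3))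
  exact ENNReal.rpow_lt_top_of_nonneg (by simp) (by simp)

/-- The parametrization of the face expands distances at least by the factor `r`, hence areas at
least by `r ^ 2`. -/
theorem area_lower_bound {T F : Finset E3} (hT : T.card = 4)
    (hi : AffineIndependent ℝ ((↑) : T → E3)) {x : E3} {r : ℝ} (hr : 0 < r)
    (hball : Metric.closedBall x r ⊆ hull T) (hFT : F ⊆ T) (hF : F.card = 3) :
    r ^ 2 * volume.real refTriangle ≤
      (Measure.euclideanHausdorffMeasure 2 : Measure E3).real (hull F) := by
  classical
  lift r to NNReal using hr.le
  have hlt := euclideanHausdorffMeasure_hull_lt_top hF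
  obtain ⟨i, j, k, hij, hik, hjk, rfl⟩ := Finset.card_eq_three.1 hF
  obtain ⟨A, hA1, hA0, hA⟩ := exists_barycentric hT hi hr hball (i := j) (hFT (by simp))
  obtain ⟨A', hA'1, hA'0, hA'⟩ := exists_barycentric hT hi hr hball (i := k) (hFT (by simp))
  have hanti := antilipschitzWith_planeMap (i := i) (j := j) (k := k) (r := r) hr hA hA'
    (hA0 i (hFT (by simp)) hij) hA1 (hA0 k (hFT (by simp)) hjk.symm)
    (hA'0 i (hFT (by simp)) hik) (hA'0 j (hFT (by simp)) hjk) hA'1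
  have h1 : hull {i, j, k} = planeMap i j k '' refTriangle := by
    rw [planeMap_image_refTriangle]
    simp [hull]
  have h2 := hanti.le_hausdorffMeasure_image (d := (2 : ℕ)) (by simp) refTriangle
  rw [← h1] at h2
  have h3 : volume refTriangle ≤ (r⁻¹ : NNReal) ^ 2 *
      Measure.euclideanHausdorffMeasure 2 (hull {i, j, k}) := by
    rw [← EuclideanSpace.euclideanHausdorffMeasure_eq_volume,
      Measure.euclideanHausdorffMeasure_def, Measure.euclideanHausdorffMeasure_def,
      Measure.smul_apply, Measure.smul_apply, ENNReal.smul_def, ENNReal.smul_def, smul_eq_mul,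
      smul_eq_mul, mul_left_comm]
    refine mul_le_mul_right ?_ _
    simpa using h2
  have h4 := ENNReal.toReal_mono (ENNReal.mul_ne_top (by simp) hlt.ne) h3
  rw [ENNReal.toReal_mul] at h4
  simp only [ENNReal.toReal_pow, ENNReal.coe_toReal, NNReal.coe_inv] at h4
  rw [Measure.real, Measure.real]
  calc (r : ℝ) ^ 2 * (volume refTriangle).toReal ≤ r ^ 2 * _ :=
        mul_le_mul_of_nonneg_left h4 (by positivity)
    _ = _ := by
      field_simp

/-- The inverse estimate for cubics on a triangle, between `L^∞` and `L²`. -/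
theorem IsBlossom.sq_le_integral {b : E3 → E3 → E3 →ᵃ[ℝ] ℝ} {q : E3 → ℝ} (h : IsBlossom b q)
    (hq : Continuous q) {F : Finset E3} (hF : F.card = 3) {a : ℝ} (ha : 0 < a)
    (harea : a ≤ (Measure.euclideanHausdorffMeasure 2 : Measure E3).real (hull F)) {x : E3}
    (hx : x ∈ hull F) :
    q x ^ 2 ≤ 40000 / a * ∫ y in hull F, q y ^ 2 ∂(Measure.euclideanHausdorffMeasure 2) := by
  set μ : Measure E3 := Measure.euclideanHausdorffMeasure 2 with hμ
  have hcomp : IsCompact (hull F) := F.finite_toSet.isCompact_convexHull ℝ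
  have hconv : Convex ℝ (hull F) := convex_convexHull ℝ _
  obtain ⟨x₀, hx₀, hmax⟩ := hcomp.exists_isMaxOn ⟨x, hx⟩ (hq.abs.continuousOn)
  have hmax' : ∀ y ∈ hull F, |q y| ≤ |q x₀| := fun y hy => hmax hy
  have hlt : μ (hull F) < ⊤ := euclideanHausdorffMeasure_hull_lt_top hF
  -- The triangle is shrunk by 100 towards a maximum point of `|q|`. By the Bernstein form and the
  -- bound 9 on the blossom, `|q|` stays above half its maximum on `S`. The area of `S` is `1 / 100
  -- ^ 2` of the whole, whence `40000 = 4 * 100 ^ 2`.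
  set S := AffineMap.homothety x₀ (1 / 100 : ℝ) '' hull F with hS
  have hSsub : S ⊆ hull F := by
    rintro _ ⟨y, hy, rfl⟩
    rw [AffineMap.homothety_eq_lineMap]
    exact hconv.lineMap_mem hx₀ hy (by norm_num)
  have hSc : IsCompact S := hcomp.image (AffineMap.homothety_continuous _ _)
  have hlow : ∀ y ∈ S, q x₀ ^ 2 / 4 ≤ q y ^ 2 := by
    rintro _ ⟨y, hy, rfl⟩
    rw [AffineMap.homothety_eq_lineMap, h.apply_lineMap]
    have h1 := abs_le.1 (h.abs_le_of_convex hconv hmax' hx₀ hx₀ hy)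
    have h2 := abs_le.1 (h.abs_le_of_convex hconv hmax' hx₀ hy hy)
    have h3 := abs_le.1 (hmax' y hy)
    rw [← sq_abs (q x₀)]
    rcases abs_cases (q x₀) with ⟨h4, h5⟩ | ⟨h4, h5⟩
    · rw [h4] at h1 h2 h3 ⊢
      have : q x₀ / 2 ≤ (1 - 1 / 100) ^ 3 * q x₀ + 3 * (1 - 1 / 100) ^ 2 * (1 / 100) * b x₀ x₀ y +
        3 * (1 - 1 / 100) * (1 / 100) ^ 2 * b x₀ y y + (1 / 100) ^ 3 * q y := by linarith
      calc q x₀ ^ 2 / 4 = (q x₀ / 2) ^ 2 := by ring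
        _ ≤ _ := pow_le_pow_left₀ (by linarith) this 2
    · rw [h4] at h1 h2 h3 ⊢
      have : -q x₀ / 2 ≤ -((1 - 1 / 100) ^ 3 * q x₀ +
        3 * (1 - 1 / 100) ^ 2 * (1 / 100) * b x₀ x₀ y +
        3 * (1 - 1 / 100) * (1 / 100) ^ 2 * b x₀ y y + (1 / 100) ^ 3 * q y) := by linarith
      calc (-q x₀) ^ 2 / 4 = (-q x₀ / 2) ^ 2 := by ring
        _ ≤ _ := pow_le_pow_left₀ (by linarith) this 2
        _ = _ := by ring
  have hint : IntegrableOn (fun y => q y ^ 2) (hull F) μ := by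
    refine Measure.integrableOn_of_bounded (M := q x₀ ^ 2) hlt.ne
      (hq.pow 2).aestronglyMeasurable ?_
    refine (ae_restrict_iff' hcomp.measurableSet).2 (Filter.Eventually.of_forall fun y hy => ?_)
    rw [Real.norm_of_nonneg (sq_nonneg _)]
    exact sq_le_sq.2 (hmax' y hy)
  have hSμ : μ.real S = (1 / 100) ^ 2 * μ.real (hull F) := by
    rw [Measure.real, hS, hμ, euclideanHausdorffMeasure_homothety_image 2 x₀ (by norm_num),
      ENNReal.smul_def, smul_eq_mul, ENNReal.toReal_mul, Measure.real]
    simp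
  have hge := setIntegral_ge_of_const_le_real hSc.measurableSet
    ((measure_mono hSsub).trans_lt hlt).ne hlow (hint.mono_set hSsub)
  have hmono := setIntegral_mono_set (μ := μ) hint
    (Filter.Eventually.of_forall fun y => sq_nonneg (q y)) (LE.le.eventuallyLE hSsub)
  rw [hSμ] at hge
  have hle : q x ^ 2 ≤ q x₀ ^ 2 := sq_le_sq.2 (hmax' x hx)
  rw [div_mul_eq_mul_div, le_div_iff₀ ha]
  nlinarith [mul_le_mul_of_nonneg_left harea (sq_nonneg (q x₀)),
    mul_le_mul_of_nonneg_right hle ha.le]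

end WF

namespace WF

/-! ### Chains -/

/-- The chain is followed from its last visit to `A`, so that the remainder avoids `A`. -/
theorem exists_step_of_chain {α : Type*} [DecidableEq α] {r : α → α → Prop} {s : Finset α}
    {A B : α} (h : Relation.ReflTransGen (fun P Q => P ∈ s ∧ Q ∈ s ∧ r P Q) A B) (hAB : B ≠ A) :
    ∃ P ∈ s.erase A, A ∈ s ∧ r A P ∧
      Relation.ReflTransGen (fun P Q => P ∈ s.erase A ∧ Q ∈ s.erase A ∧ r P Q) P B := by
  induction h with
  | refl => exact absurd rfl hAB
  | @tail Q B' hQ hstep ih =>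
    obtain ⟨h1, h2, h3⟩ := hstep
    by_cases hQA : Q = A
    · subst hQA
      exact ⟨B', Finset.mem_erase.2 ⟨hAB, h2⟩, h1, h3, .refl⟩
    · obtain ⟨P, hP, hA, hr, hch⟩ := ih hQA
      exact ⟨P, hP, hA, hr, hch.tail ⟨Finset.mem_erase.2 ⟨hQA, h1⟩, Finset.mem_erase.2 ⟨hAB, h2⟩,
        h3⟩⟩

/-- Removing each visited element bounds the number of steps by the size of `s`, whatever the length
of the given chain. -/
theorem norm_sub_le_of_chain {α E : Type*} [SeminormedAddCommGroup E] {r : α → α → Prop}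
    (g : α → E) {δ : ℝ} (hδ : 0 ≤ δ) (s : Finset α)
    (hg : ∀ P ∈ s, ∀ Q ∈ s, r P Q → ‖g P - g Q‖ ≤ δ) {A B : α}
    (h : Relation.ReflTransGen (fun P Q => P ∈ s ∧ Q ∈ s ∧ r P Q) A B) :
    ‖g A - g B‖ ≤ s.card * δ := by
  classical
  induction hn : s.card generalizing s A with
  | zero =>
    by_cases hAB : B = A
    · simp [hAB]
    · obtain ⟨P, -, hA, -⟩ := exists_step_of_chain h hAB
      rw [Finset.card_eq_zero.1 hn] at hA
      simp at hA
  | succ n ih =>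
    by_cases hAB : B = A
    · simp only [hAB, sub_self, norm_zero]
      positivity
    · obtain ⟨P, hP, hA, hr, hch⟩ := exists_step_of_chain h hAB
      have h1 := hg A hA P (Finset.mem_of_mem_erase hP) hr
      have h2 := ih (s.erase A) (fun P hP Q hQ => hg P (Finset.mem_of_mem_erase hP) Q
        (Finset.mem_of_mem_erase hQ)) hch (by rw [Finset.card_erase_of_mem hA, hn]; rfl)
      rw [← sub_add_sub_cancel (g A) (g P) (g B)]
      refine (norm_add_le _ _).trans ?_
      push_cast
      linarith

namespace TetMesh

variable {K : TetMesh}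

/-! ### Elementary facts on meshes -/

theorem mem_simplices {s : Finset E3} {n : ℕ} : s ∈ K.simplices n ↔ s ∈ K.faces ∧ s.card = n := by
  simp [simplices]

theorem mem_star {s T : Finset E3} : T ∈ K.star s ↔ T ∈ K.tets ∧ s ⊆ T := by
  simp [star]

theorem mem_interiorFaces {s F : Finset E3} :
    F ∈ K.interiorFaces s ↔ F ∈ K.simplices 3 ∧ s ⊆ F ∧ 1 < (K.star F).card := by
  simp [interiorFaces]

theorem card_of_mem_tets {T : Finset E3} (h : T ∈ K.tets) : T.card = 4 := (mem_simplices.1 h).2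

theorem indep_of_mem_tets {T : Finset E3} (h : T ∈ K.tets) :
    AffineIndependent ℝ ((↑) : T → E3) := K.indep (mem_simplices.1 h).1

theorem mem_simplices_of_subset {s T : Finset E3} {n : ℕ} (hT : T ∈ K.tets) (hs : s ⊆ T)
    (hn : s.card = n) (hpos : 0 < n) : s ∈ K.simplices n :=
  mem_simplices.2 ⟨K.down_closed (mem_simplices.1 hT).1 hs (Finset.card_pos.1 (by omega)), hn⟩

theorem star_anti {s s' : Finset E3} (h : s ⊆ s') : K.star s' ⊆ K.star s := fun _ hT =>
  mem_star.2 ⟨(mem_star.1 hT).1, h.trans (mem_star.1 hT).2⟩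

theorem interiorFaces_anti {s s' : Finset E3} (h : s ⊆ s') :
    K.interiorFaces s' ⊆ K.interiorFaces s := fun F hF => by
  rw [mem_interiorFaces] at hF ⊢
  exact ⟨hF.1, h.trans hF.2.1, hF.2.2⟩

/-- Distinct tetrahedra share at most three vertices, so the common face is `A ∩ B`, which contains
`s`. -/
theorem mem_interiorFaces_of_ne {s F A B : Finset E3} (hA : A ∈ K.star s) (hB : B ∈ K.star s)
    (hAB : A ≠ B) (hF : F ∈ K.simplices 3) (hFA : F ⊆ A) (hFB : F ⊆ B) :
    F ∈ K.interiorFaces s := by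
  classical
  have hA' := mem_star.1 hA
  have hB' := mem_star.1 hB
  have hlt : (A ∩ B).card < 4 := by
    by_contra hcon
    have h1 : A ∩ B = A := Finset.eq_of_subset_of_card_le Finset.inter_subset_left
      (by rw [card_of_mem_tets hA'.1]; omega)
    exact hAB (Finset.eq_of_subset_of_card_le (Finset.inter_eq_left.1 h1)
      (by rw [card_of_mem_tets hA'.1, card_of_mem_tets hB'.1]))
  have hFeq : F = A ∩ B := Finset.eq_of_subset_of_card_le (Finset.subset_inter hFA hFB)
    (by rw [(mem_simplices.1 hF).2]; omega)
  refine mem_interiorFaces.2 ⟨hF, ?_, Finset.one_lt_card.2 ⟨A, mem_star.2 ⟨hA'.1, hFA⟩, B,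
    mem_star.2 ⟨hB'.1, hFB⟩, hAB⟩⟩
  rw [hFeq]
  exact Finset.subset_inter hA'.2 hB'.2

/-- If the jumps of `g` across the interior faces containing `s` are at most `δ`, then the values of
`g` on the tetrahedra containing `s` are close to their average. -/
theorem norm_sub_average_le {E : Type*} [NormedAddCommGroup E] [NormedSpace ℝ E]
    (hK : K.LocallyFaceConnected) {s : Finset E3} (hs : s ∈ K.faces) (g : Finset E3 → E) {δ N : ℝ}
    (hδ : 0 ≤ δ) (hN : ((K.star s).card : ℝ) ≤ N)
    (hg : ∀ F ∈ K.interiorFaces s, ∀ A ∈ K.star F, ∀ B ∈ K.star F, ‖g A - g B‖ ≤ δ)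
    {T : Finset E3} (hT : T ∈ K.star s) :
    ‖g T - ((K.star s).card : ℝ)⁻¹ • ∑ A ∈ K.star s, g A‖ ≤ N * δ := by
  have hdiff : ∀ A ∈ K.star s, ‖g T - g A‖ ≤ N * δ := by
    intro A hA
    refine (norm_sub_le_of_chain g hδ (K.star s) (fun P hP Q hQ hPQ => ?_)
      (hK s hs T hT A hA)).trans (mul_le_mul_of_nonneg_right hN hδ)
    obtain ⟨F, hF, hFP, hFQ⟩ := hPQ
    by_cases hne : P = Q
    · simp [hne, hδ]
    · exact hg F (mem_interiorFaces_of_ne hP hQ hne hF hFP hFQ) P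
        (mem_star.2 ⟨(mem_star.1 hP).1, hFP⟩) Q (mem_star.2 ⟨(mem_star.1 hQ).1, hFQ⟩)
  have hcard : ((K.star s).card : ℝ) ≠ 0 := by
    exact_mod_cast (Finset.card_pos.2 ⟨T, hT⟩).ne'
  have heq : g T - ((K.star s).card : ℝ)⁻¹ • ∑ A ∈ K.star s, g A =
      ((K.star s).card : ℝ)⁻¹ • ∑ A ∈ K.star s, (g T - g A) := by
    rw [Finset.sum_sub_distrib, Finset.sum_const, smul_sub, ← Nat.cast_smul_eq_nsmul ℝ, smul_smul,
      inv_mul_cancel₀ hcard, one_smul]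
  rw [heq, norm_smul, norm_inv, Real.norm_natCast, inv_mul_le_iff₀ (by positivity)]
  refine (norm_sum_le _ _).trans ((Finset.sum_le_sum hdiff).trans ?_)
  simp

/-! ### Shape regularity -/

theorem isCompact_hull (T : Finset E3) : IsCompact (hull T) := T.finite_toSet.isCompact_convexHull ℝ

theorem norm_sub_le_diam {T : Finset E3} {x y : E3} (hx : x ∈ hull T) (hy : y ∈ hull T) :
    ‖x - y‖ ≤ Metric.diam (hull T) := by
  rw [← dist_eq_norm]
  exact Metric.dist_le_diam_of_mem (isCompact_hull T).isBounded hx hy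

theorem diam_pos {T : Finset E3} (hT : T ∈ K.tets) : 0 < Metric.diam (hull T) := by
  obtain ⟨i, hi, j, hj, hij⟩ := Finset.one_lt_card.1
    (by rw [card_of_mem_tets hT]; norm_num : 1 < T.card)
  exact (norm_pos_iff.2 (sub_ne_zero.2 hij)).trans_le (norm_sub_le_diam (mem_hull hi) (mem_hull hj))

theorem ShapeRegular.pos {γ : ℝ} (hγ : K.ShapeRegular γ) {T : Finset E3} (hT : T ∈ K.tets) :
    0 < γ := by
  obtain ⟨x, r, hr, -, hd⟩ := hγ T hT
  exact pos_of_mul_pos_left ((diam_pos hT).trans_le hd) hr.le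

/-- The intersection is the simplex on the common vertices. An interior point would require four of
these, and then `A = B`. -/
theorem disjoint_interior_hull {A B : Finset E3} (hA : A ∈ K.tets) (hB : B ∈ K.tets)
    (hAB : A ≠ B) : Disjoint (interior (hull A)) (interior (hull B)) := by
  classical
  rw [Set.disjoint_iff_inter_eq_empty, ← interior_inter, ← Set.not_nonempty_iff_eq_empty]
  intro hne
  have hsub : hull A ∩ hull B ⊆ convexHull ℝ ((A ∩ B : Finset E3) : Set E3) := by
    rw [Finset.coe_inter]
    exact K.inter_subset_convexHull (mem_simplices.1 hA).1 (mem_simplices.1 hB).1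
  have hne' := hne.mono (interior_mono hsub)
  rw [interior_convexHull_nonempty_iff_affineSpan_eq_top] at hne'
  have hi : AffineIndependent ℝ ((↑) : (A ∩ B : Finset E3) → E3) :=
    AffineIndependent.mono (indep_of_mem_tets hA)
      (by simp : ((A ∩ B : Finset E3) : Set E3) ⊆ (A : Set E3))
  have hcard := (hi.affineSpan_eq_top_iff_card_eq_finrank_add_one).1 (by
    rw [Subtype.range_coe_subtype]
    exact hne')
  simp only [Fintype.card_coe, finrank_euclideanSpace, Fintype.card_fin] at hcard
  have h1 : A ∩ B = A := Finset.eq_of_subset_of_card_le Finset.inter_subset_left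
    (by rw [card_of_mem_tets hA, hcard])
  exact hAB (Finset.eq_of_subset_of_card_le (Finset.inter_eq_left.1 h1)
    (by rw [card_of_mem_tets hA, card_of_mem_tets hB]))

/-- Near each of its vertices `p`, a shape regular tetrahedron contains large balls. -/
theorem ShapeRegular.exists_ball {γ : ℝ} (hγ : K.ShapeRegular γ) {T : Finset E3} (hT : T ∈ K.tets)
    {p : E3} (hp : p ∈ T) {ε : ℝ} (hε : 0 < ε) (hεT : ε ≤ Metric.diam (hull T)) :
    ∃ z, Metric.ball z (ε / γ) ⊆ interior (hull T) ∩ Metric.closedBall p ε := by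
  have hγ0 := hγ.pos hT
  obtain ⟨x, r, hr, hball, hd⟩ := hγ T hT
  have hd0 := diam_pos hT
  set d := Metric.diam (hull T) with hdef
  -- The homothety with centre `p` and ratio `t` shrinks `T` to diameter `ε` and its inscribed ball
  -- to radius `t * r ≥ ε / γ`.
  set t := ε / d with ht
  have ht0 : 0 < t := div_pos hε hd0
  have ht1 : t ≤ 1 := (div_le_one hd0).2 hεT
  have hsub : Metric.ball (AffineMap.lineMap p x t) (ε / γ) ⊆ hull T ∩ Metric.closedBall p ε := by
    intro y hy
    have hy' : ‖y - AffineMap.lineMap p x t‖ < ε / γ := by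
      simpa [dist_eq_norm] using hy
    set x' := p + t⁻¹ • (y - p) with hx'
    have hyx : y = AffineMap.lineMap p x' t := by
      rw [AffineMap.lineMap_apply_module', hx', add_sub_cancel_left, smul_smul,
        mul_inv_cancel₀ ht0.ne', one_smul, sub_add_cancel]
    have hxx : x' - x = t⁻¹ • (y - AffineMap.lineMap p x t) := by
      rw [AffineMap.lineMap_apply_module', hx', ← sub_sub, sub_right_comm y, smul_sub t⁻¹ (y - p),
        smul_smul, inv_mul_cancel₀ ht0.ne', one_smul]
      abel
    have hx'T : x' ∈ hull T := by
      refine hball ?_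
      rw [mem_closedBall_iff_norm, hxx, norm_smul, norm_inv, Real.norm_of_nonneg ht0.le,
        inv_mul_le_iff₀ ht0]
      refine hy'.le.trans ?_
      rw [ht, div_mul_eq_mul_div, div_le_div_iff₀ hγ0 hd0]
      nlinarith
    refine ⟨?_, ?_⟩
    · rw [hyx]
      exact (convex_convexHull ℝ _).lineMap_mem (mem_hull hp) hx'T ⟨ht0.le, ht1⟩
    · have h1 : y - p = t • (x' - p) := by
        rw [hx', add_sub_cancel_left, smul_smul, mul_inv_cancel₀ ht0.ne', one_smul]
      rw [mem_closedBall_iff_norm, h1, norm_smul, Real.norm_of_nonneg ht0.le]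
      calc t * ‖x' - p‖ ≤ t * d :=
            mul_le_mul_of_nonneg_left (norm_sub_le_diam hx'T (mem_hull hp)) ht0.le
        _ = ε := div_mul_cancel₀ _ hd0.ne'
  exact ⟨_, Set.subset_inter (Metric.isOpen_ball.subset_interior_iff.2
    (hsub.trans Set.inter_subset_left)) (hsub.trans Set.inter_subset_right)⟩

/-- Packing: with `ε` the least diameter around `p`, the tetrahedra contain disjoint balls of radius
`ε / γ` inside the ball of radius `ε` about `p`. Comparing volumes gives at most `γ ^ 3` of them. -/
theorem ShapeRegular.card_star_le {γ : ℝ} (hγ : K.ShapeRegular γ) {s : Finset E3}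
    (hs : s.Nonempty) : (K.star s).card ≤ ⌈γ ^ 3⌉₊ := by
  obtain ⟨p, hp⟩ := hs
  refine (Finset.card_le_card (star_anti (Finset.singleton_subset_iff.2 hp))).trans ?_
  rcases (K.star {p}).eq_empty_or_nonempty with hemp | hne
  · simp [hemp]
  obtain ⟨T₀, hT₀, hmin⟩ :=
    Finset.exists_min_image (K.star {p}) (fun T => Metric.diam (hull T)) hne
  set ε := Metric.diam (hull T₀) with hε
  have hε0 : 0 < ε := diam_pos (mem_star.1 hT₀).1
  have hγ0 := hγ.pos (mem_star.1 hT₀).1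
  have hex : ∀ T, ∃ z, T ∈ K.star {p} →
      Metric.ball z (ε / γ) ⊆ interior (hull T) ∩ Metric.closedBall p ε := by
    intro T
    by_cases hT : T ∈ K.star {p}
    · obtain ⟨z, hz⟩ := hγ.exists_ball (mem_star.1 hT).1
        (Finset.singleton_subset_iff.1 (mem_star.1 hT).2) hε0 (hmin T hT)
      exact ⟨z, fun _ => hz⟩
    · exact ⟨0, fun h => absurd h hT⟩
  choose z hz using hex
  have hdisj : (K.star {p} : Set (Finset E3)).PairwiseDisjoint
      (fun T => Metric.ball (z T) (ε / γ)) := by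
    intro A hA B hB hAB
    exact (disjoint_interior_hull (mem_star.1 hA).1 (mem_star.1 hB).1 hAB).mono
      ((hz A hA).trans Set.inter_subset_left) ((hz B hB).trans Set.inter_subset_left)
  have hvol := measure_biUnion_finset (μ := (volume : Measure E3)) hdisj
    (fun T _ => measurableSet_ball)
  have hle : volume (⋃ T ∈ K.star {p}, Metric.ball (z T) (ε / γ)) ≤
      volume (Metric.closedBall p ε) :=
    measure_mono (Set.iUnion₂_subset fun T hT => (hz T hT).trans Set.inter_subset_right)
  rw [hvol] at hle
  simp only [Measure.addHaar_ball volume _ (div_nonneg hε0.le hγ0.le),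
    Measure.addHaar_closedBall volume _ hε0.le, Finset.sum_const, finrank_euclideanSpace,
    Fintype.card_fin, nsmul_eq_mul] at hle
  have hV0 : (volume (Metric.ball (0 : E3) 1)) ≠ 0 := (Metric.measure_ball_pos _ _ one_pos).ne'
  have hVt : (volume (Metric.ball (0 : E3) 1)) ≠ ⊤ := measure_ball_lt_top.ne
  rw [← mul_assoc, ENNReal.mul_le_mul_iff_left hV0 hVt, ← ENNReal.ofReal_natCast,
    ← ENNReal.ofReal_mul (by positivity), ENNReal.ofReal_le_ofReal_iff (by positivity), div_pow,
    mul_div_assoc', div_le_iff₀ (by positivity), mul_comm,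
    mul_le_mul_iff_right₀ (by positivity)] at hle
  exact_mod_cast hle.trans (Nat.le_ceil _)

/-- An edge of the common face is at least as long as the diameter of the ball inscribed in `A` and
at most as long as the diameter of `B`. -/
theorem ShapeRegular.diam_le_of_face {γ : ℝ} (hγ : K.ShapeRegular γ) {A B F : Finset E3}
    (hA : A ∈ K.tets) (hF : F ∈ K.simplices 3) (hFA : F ⊆ A) (hFB : F ⊆ B) :
    Metric.diam (hull A) ≤ γ * Metric.diam (hull B) := by
  have hγ0 := hγ.pos hA
  obtain ⟨x, r, hr, hball, hd⟩ := hγ A hA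
  obtain ⟨i, hi, j, hj, hij⟩ := Finset.one_lt_card.1
    (by rw [(mem_simplices.1 hF).2]; norm_num : 1 < F.card)
  have h1 := two_mul_radius_le_norm_sub (card_of_mem_tets hA) (indep_of_mem_tets hA) hr hball
    (hFA hi) (hFA hj) hij
  have h2 := norm_sub_le_diam (mem_hull (hFB hi)) (mem_hull (hFB hj))
  exact hd.trans (mul_le_mul_of_nonneg_left (by linarith) hγ0.le)

/-- Tetrahedra that share a vertex have comparable diameters. -/
theorem ShapeRegular.diam_le {γ : ℝ} (hγ : K.ShapeRegular γ) (hK : K.LocallyFaceConnected)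
    {s A B : Finset E3} (hs : s ∈ K.faces) (hA : A ∈ K.star s) (hB : B ∈ K.star s) :
    Metric.diam (hull A) ≤ Real.exp (⌈γ ^ 3⌉₊ * |Real.log γ|) * Metric.diam (hull B) := by
  have hγ0 := hγ.pos (mem_star.1 hA).1
  have hdA := diam_pos (mem_star.1 hA).1
  have hdB := diam_pos (mem_star.1 hB).1
  have hlog : ∀ {P Q F : Finset E3}, P ∈ K.tets → Q ∈ K.tets → F ∈ K.simplices 3 → F ⊆ P →
      F ⊆ Q → Real.log (Metric.diam (hull P)) - Real.log (Metric.diam (hull Q)) ≤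
        |Real.log γ| := by
    intro P Q F hP hQ hF hFP hFQ
    have h1 := Real.log_le_log (diam_pos hP) (hγ.diam_le_of_face hP hF hFP hFQ)
    rw [Real.log_mul hγ0.ne' (diam_pos hQ).ne'] at h1
    linarith [le_abs_self (Real.log γ)]
  -- Logarithms turn the factors `γ` picked up along the chain into a sum, to which the chain lemma
  -- applies.
  have h := norm_sub_le_of_chain (fun T => Real.log (Metric.diam (hull T)))
    (abs_nonneg (Real.log γ)) (K.star s) (fun P hP Q hQ ⟨F, hF, hFP, hFQ⟩ => by
      rw [Real.norm_eq_abs, abs_le]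
      have h1 := hlog (mem_star.1 hP).1 (mem_star.1 hQ).1 hF hFP hFQ
      have h2 := hlog (mem_star.1 hQ).1 (mem_star.1 hP).1 hF hFQ hFP
      constructor <;> linarith) (hK s hs A hA B hB)
  have hcard : ((K.star s).card : ℝ) ≤ ⌈γ ^ 3⌉₊ := by
    exact_mod_cast hγ.card_star_le (K.nonempty_of_mem_faces hs)
  have h' := (le_abs_self _).trans (h.trans (mul_le_mul_of_nonneg_right hcard (abs_nonneg _)))
  rw [sub_le_iff_le_add, Real.log_le_iff_le_exp hdA, Real.exp_add, Real.exp_log hdB] at h'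
  exact h'

end TetMesh

/-! ### Positive barycentric weights of the split points -/

theorem IsWFSplit.isPosComb_center {K : TetMesh} {c f : Finset E3 → E3} (h : IsWFSplit K c f)
    {T : Finset E3} (hT : T ∈ K.tets) : IsPosComb T (c T) := by
  classical
  obtain ⟨s, hs, hc⟩ := h.incenter T hT
  have hTs : T = Finset.univ.image s.points := by
    apply Finset.coe_injective
    simp [hs]
  have hinj := s.independent.injective
  -- The incenter is the excenter for the empty set of sign changes, so its weights are positive.
  refine ⟨Function.extend s.points (s.excenterWeights ∅) 0, ?_, ?_, ?_⟩
  · intro x hx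
    rw [hTs] at hx
    obtain ⟨i, -, rfl⟩ := Finset.mem_image.1 hx
    rw [hinj.extend_apply]
    exact s.excenterWeights_empty_pos i
  · rw [hTs, Finset.sum_image fun _ _ _ _ h => hinj h]
    simp only [hinj.extend_apply]
    exact s.excenterExists_empty.sum_excenterWeights_eq_one
  · rw [hc, s.incenter_eq_affineCombination, hTs, Finset.sum_image fun _ _ _ _ h => hinj h,
      Finset.affineCombination_eq_linear_combination _ _ _
        s.excenterExists_empty.sum_excenterWeights_eq_one]
    simp only [hinj.extend_apply]

theorem IsWFSplit.isPosComb_face {K : TetMesh} {c f : Finset E3 → E3} (h : IsWFSplit K c f)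
    {T : Finset E3} (hT : T ∈ K.tets) : ∀ F ∈ T.powersetCard 3, IsPosComb F (f F) := by
  intro F hF
  rw [Finset.mem_powersetCard] at hF
  exact h.face_mem F (TetMesh.mem_simplices_of_subset hT hF.1 hF.2 (by norm_num))

end WF

namespace WF

/-! ### Jump estimates -/

variable {K : TetMesh}

theorem faceJumpSq_nonneg (F : Finset E3) (g : Finset E3 → E3 → ℝ) : 0 ≤ faceJumpSq K F g := by
  rw [faceJumpSq]
  exact mul_nonneg (by norm_num) (Finset.sum_nonneg fun A _ => Finset.sum_nonneg fun B _ =>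
    integral_nonneg fun x => sq_nonneg _)

/-- Both ordered pairs `(A, B)` and `(B, A)` occur in the double sum, which cancels the factor `1 /
2`. -/
theorem integral_sq_sub_le_faceJumpSq {F A B : Finset E3} (hA : A ∈ K.star F) (hB : B ∈ K.star F)
    (hAB : A ≠ B) (g : Finset E3 → E3 → ℝ) :
    ∫ x in hull F, (g A x - g B x) ^ 2 ∂(Measure.euclideanHausdorffMeasure 2) ≤
      faceJumpSq K F g := by
  classical
  set I : Finset E3 → Finset E3 → ℝ := fun P Q =>
    ∫ x in hull F, (g P x - g Q x) ^ 2 ∂(Measure.euclideanHausdorffMeasure 2) with hI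
  have hI0 : ∀ P Q, 0 ≤ I P Q := fun P Q => integral_nonneg fun x => sq_nonneg _
  have hsymm : I B A = I A B := by
    simp only [hI]
    congr 1
    funext x
    ring
  have h1 : ∑ P ∈ ({A, B} : Finset (Finset E3)), ∑ Q ∈ K.star F, I P Q ≤
      ∑ P ∈ K.star F, ∑ Q ∈ K.star F, I P Q :=
    Finset.sum_le_sum_of_subset_of_nonneg (by simp [Finset.insert_subset_iff, hA, hB])
      fun P _ _ => Finset.sum_nonneg fun Q _ => hI0 P Q
  rw [Finset.sum_pair hAB] at h1
  have h2 := Finset.single_le_sum (f := fun Q => I A Q) (fun Q _ => hI0 A Q) hB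
  have h3 := Finset.single_le_sum (f := fun Q => I B Q) (fun Q _ => hI0 B Q) hA
  have h4 : faceJumpSq K F g = 1 / 2 * ∑ P ∈ K.star F, ∑ Q ∈ K.star F, I P Q := rfl
  rw [h4]
  change I A B ≤ _
  linarith

theorem volume_real_refTriangle_pos : 0 < volume.real refTriangle :=
  ENNReal.toReal_pos volume_refTriangle_pos.ne' volume_refTriangle_lt_top.ne

/-- The face `F` is at least of size `ρ`. -/
structure FaceSize (F : Finset E3) (ρ : ℝ) : Prop where
  pos : 0 < ρ
  card : F.card = 3
  area : ρ ^ 2 * volume.real refTriangle ≤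
    (Measure.euclideanHausdorffMeasure 2 : Measure E3).real (hull F)
  edge : ∀ i ∈ F, ∀ j ∈ F, i ≠ j → 2 * ρ ≤ ‖j - i‖

theorem sq_jump_le {F A B : Finset E3} {ρ : ℝ} (hF : FaceSize F ρ) (hA : A ∈ K.star F)
    (hB : B ∈ K.star F) (g : Finset E3 → E3 → ℝ) (hg : ∃ b, IsBlossom b fun x => g A x - g B x)
    (hcont : Continuous fun x => g A x - g B x) {x : E3} (hx : x ∈ hull F) :
    (g A x - g B x) ^ 2 ≤ 40000 / (ρ ^ 2 * volume.real refTriangle) * faceJumpSq K F g := by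
  have hpos : 0 < ρ ^ 2 * volume.real refTriangle :=
    mul_pos (pow_pos hF.pos 2) volume_real_refTriangle_pos
  by_cases hAB : A = B
  · simp only [hAB, sub_self, ne_eq, OfNat.ofNat_ne_zero, not_false_eq_true, zero_pow]
    exact mul_nonneg (by positivity) (faceJumpSq_nonneg F g)
  · obtain ⟨b, hb⟩ := hg
    exact (hb.sq_le_integral hcont hF.card hpos hF.area hx).trans
      (mul_le_mul_of_nonneg_left (integral_sq_sub_le_faceJumpSq hA hB hAB g) (by positivity))

section

variable {uT : Finset E3 → MvPolynomial (Fin 3) ℝ} {F A B : Finset E3} {ρ : ℝ} {x : E3}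

theorem polyFun_sub_eq (P Q : MvPolynomial (Fin 3) ℝ) :
    polyFun (P - Q) = fun x => polyFun P x - polyFun Q x := funext (polyFun_sub P Q)

theorem fderiv_polyFun_sub (P Q : MvPolynomial (Fin 3) ℝ) (x : E3) :
    fderiv ℝ (polyFun (P - Q)) x = fderiv ℝ (polyFun P) x - fderiv ℝ (polyFun Q) x := by
  rw [polyFun_sub_eq]
  exact fderiv_fun_sub (differentiable_polyFun P x) (differentiable_polyFun Q x)

theorem sq_value_jump_le (hdeg : ∀ T ∈ K.tets, (uT T).totalDegree ≤ 3) (hF : FaceSize F ρ)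
    (hA : A ∈ K.star F) (hB : B ∈ K.star F) (hx : x ∈ hull F) :
    (polyFun (uT A) x - polyFun (uT B) x) ^ 2 ≤
      40000 / (ρ ^ 2 * volume.real refTriangle) * jumpSq K uT F := by
  refine sq_jump_le hF hA hB (fun T x => polyFun (uT T) x) ?_ ?_ hx
  · simp only [← polyFun_sub]
    exact exists_isBlossom_polyFun _ (totalDegree_sub_le (hdeg A (TetMesh.mem_star.1 hA).1)
      (hdeg B (TetMesh.mem_star.1 hB).1))
  · simp only [← polyFun_sub]
    exact (differentiable_polyFun _).continuous

theorem sq_deriv_jump_le (hdeg : ∀ T ∈ K.tets, (uT T).totalDegree ≤ 3) (hF : FaceSize F ρ)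
    (hA : A ∈ K.star F) (hB : B ∈ K.star F) (hx : x ∈ hull F) (v : E3) :
    (fderiv ℝ (polyFun (uT A)) x v - fderiv ℝ (polyFun (uT B)) x v) ^ 2 ≤
      40000 / (ρ ^ 2 * volume.real refTriangle) * derivJumpSq K uT F v := by
  have heq : ∀ x, fderiv ℝ (polyFun (uT A)) x v - fderiv ℝ (polyFun (uT B)) x v =
      fderiv ℝ (polyFun (uT A - uT B)) x v := fun x => by
    rw [fderiv_polyFun_sub, sub_apply]
  refine sq_jump_le hF hA hB (fun T x => fderiv ℝ (polyFun (uT T)) x v) ?_ ?_ hx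
  · obtain ⟨b, hb⟩ := exists_isBlossom_polyFun _ (totalDegree_sub_le
      (hdeg A (TetMesh.mem_star.1 hA).1) (hdeg B (TetMesh.mem_star.1 hB).1))
    simp only [heq]
    exact hb.exists_fderiv (differentiable_polyFun _) v
  · simp only [heq]
    exact ((contDiff_polyFun _).continuous_fderiv (by simp)).clm_apply continuous_const

/-- In the orthonormal basis adapted to `e`, the two normal components are the jumps in `D_F`. The
tangential one is bounded, in the manner of Markov's inequality, by the jump of `u` on `F` divided
by the length of `e`. -/
theorem sq_norm_gradient_jump_le (hdeg : ∀ T ∈ K.tets, (uT T).totalDegree ≤ 3)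
    (hF : FaceSize F ρ) (hA : A ∈ K.star F) (hB : B ∈ K.star F) (hx : x ∈ hull F)
    {ν : Finset E3 → Fin 2 → E3} (hν : IsEdgeFrame K ν) {e : Finset E3} (he : e ⊆ F)
    (hcard : e.card = 2) :
    ‖fderiv ℝ (polyFun (uT A)) x - fderiv ℝ (polyFun (uT B)) x‖ ^ 2 ≤
      3 * (40000 / (ρ ^ 2 * volume.real refTriangle)) *
        (729 / ρ ^ 2 * jumpSq K uT F + (derivJumpSq K uT F (ν e 0) + derivJumpSq K uT F (ν e 1))) := by
  classical
  set C := 40000 / (ρ ^ 2 * volume.real refTriangle) with hC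
  have hρ := hF.pos
  have hA' := TetMesh.mem_star.1 hA
  obtain ⟨hon, hperp⟩ := hν e (TetMesh.mem_simplices_of_subset hA'.1 (he.trans hA'.2) hcard
    (by norm_num))
  obtain ⟨i, j, hij, rfl⟩ := Finset.card_eq_two.1 hcard
  have hiF : i ∈ F := he (by simp)
  have hjF : j ∈ F := he (by simp)
  obtain ⟨b, hb⟩ := exists_isBlossom_polyFun _ (totalDegree_sub_le (hdeg A hA'.1)
    (hdeg B (TetMesh.mem_star.1 hB).1))
  set q := polyFun (uT A - uT B) with hq
  have hdq : DifferentiableAt ℝ q x := differentiable_polyFun _ x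
  have hsup : ∀ y ∈ hull F, |q y| ≤ Real.sqrt (C * jumpSq K uT F) := fun y hy => by
    rw [hq, polyFun_sub]
    exact Real.abs_le_sqrt (sq_value_jump_le hdeg hF hA hB hy)
  have hCJ : 0 ≤ C * jumpSq K uT F :=
    (sq_nonneg _).trans (sq_value_jump_le hdeg hF hA hB hx)
  set M := Real.sqrt (C * jumpSq K uT F) with hM
  have hM2 : M ^ 2 = C * jumpSq K uT F := Real.sq_sqrt hCJ
  have hM0 : 0 ≤ M := Real.sqrt_nonneg _
  set L := fderiv ℝ q x with hL
  -- The constant is `54 = 3 * (9 + 9)`. Dividing by an edge of length at least `2 * ρ` leaves `27 /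
  -- ρ`, with square `729 / ρ ^ 2`.
  have htan : |L (j - i)| ≤ 54 * M := by
    have h1 : L (j - i) = 3 * b x x j - 3 * b x x i := by
      rw [← sub_sub_sub_cancel_right j i x, map_sub, hL, hb.fderiv_apply hdq, hb.fderiv_apply hdq,
        add_sub_cancel, add_sub_cancel]
      ring
    have h2 := abs_le.1 (hb.abs_le_of_convex (convex_convexHull ℝ _) hsup hx hx (mem_hull hjF))
    have h3 := abs_le.1 (hb.abs_le_of_convex (convex_convexHull ℝ _) hsup hx hx (mem_hull hiF))
    rw [h1, abs_le]
    constructor <;> linarith [h2.1, h2.2, h3.1, h3.2]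
  have hedge := hF.edge i hiF j hjF hij
  have htan' : |L (j - i)| / ‖j - i‖ ≤ 27 * M / ρ := by
    rw [div_le_div_iff₀ (by linarith) hρ]
    calc |L (j - i)| * ρ ≤ 54 * M * ρ := mul_le_mul_of_nonneg_right htan hρ.le
      _ = 27 * M * (2 * ρ) := by ring
      _ ≤ 27 * M * ‖j - i‖ := mul_le_mul_of_nonneg_left hedge (by positivity)
  have hν' : ∀ l, |L (ν {i, j} l)| ^ 2 ≤ C * derivJumpSq K uT F (ν {i, j} l) := fun l => by
    rw [sq_abs, hL, hq, fderiv_polyFun_sub, sub_apply]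
    exact sq_deriv_jump_le hdeg hF hA hB hx _
  have hnorm : ‖L‖ ≤ 27 * M / ρ + |L (ν {i, j} 0)| + |L (ν {i, j} 1)| := by
    refine L.opNorm_le_bound (by positivity) fun y => ?_
    rw [Real.norm_eq_abs, mul_comm]
    refine (abs_apply_le_of_frame L hon (sub_ne_zero.2 hij.symm)
      (fun l => hperp j (by simp) i (by simp) l) y).trans ?_
    gcongr
  rw [← fderiv_polyFun_sub, ← hq, ← hL]
  have h27 : (27 * M / ρ) ^ 2 = C * (729 / ρ ^ 2 * jumpSq K uT F) := by
    rw [div_pow, mul_pow, hM2]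
    ring
  have hsq : ‖L‖ ^ 2 ≤ (27 * M / ρ + |L (ν {i, j} 0)| + |L (ν {i, j} 1)|) ^ 2 :=
    pow_le_pow_left₀ (norm_nonneg _) hnorm 2
  have hcs : ∀ a b c : ℝ, (a + b + c) ^ 2 ≤ 3 * (a ^ 2 + b ^ 2 + c ^ 2) := fun a b c => by
    nlinarith [sq_nonneg (a - b), sq_nonneg (a - c), sq_nonneg (b - c)]
  have := hcs (27 * M / ρ) |L (ν {i, j} 0)| |L (ν {i, j} 1)|
  linarith [hν' 0, hν' 1]

end

/-! ### The local estimate -/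

/-- A bound on the number of tetrahedra around a vertex of a shape regular mesh. -/
noncomputable def starBound (γ : ℝ) : ℝ := ⌈γ ^ 3⌉₊

/-- A bound on the ratio of the size of a tetrahedron and the inradius of a tetrahedron sharing a
vertex with it. -/
noncomputable def sizeRatio (γ : ℝ) : ℝ := γ * Real.exp (⌈γ ^ 3⌉₊ * |Real.log γ|)

/-- The constant in the bounds of pointwise jumps by `L²` norms. -/
noncomputable def jumpConst (γ : ℝ) : ℝ :=
  2187 * (40000 / volume.real refTriangle) * (sizeRatio γ ^ 2 + sizeRatio γ ^ 4)

/-- The constant in the local estimate. -/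
noncomputable def localConst (γ : ℝ) : ℝ :=
  ((6 + 4 * γ) * starBound γ) ^ 2 * jumpConst γ * volume.real (Metric.closedBall (0 : E3) 1)

theorem jumpConst_nonneg (γ : ℝ) : 0 ≤ jumpConst γ := by
  have := volume_real_refTriangle_pos
  unfold jumpConst
  positivity

theorem localConst_nonneg (γ : ℝ) : 0 ≤ localConst γ :=
  mul_nonneg (mul_nonneg (sq_nonneg _) (jumpConst_nonneg γ)) measureReal_nonneg

theorem sizeRatio_pos {γ : ℝ} (h : 0 < γ) : 0 < sizeRatio γ := mul_pos h (Real.exp_pos _)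

/-- A tetrahedron `A` at `F` shares `s` with `T`, so its diameter and hence its inradius are
comparable to the diameter of `T`: the size chosen is at most the radius of a ball in `A`. -/
theorem faceSize_of_mem_interiorFaces {γ : ℝ} (hγ : K.ShapeRegular γ)
    (hK : K.LocallyFaceConnected) {s T F : Finset E3} (hs : s ∈ K.faces) (hT : T ∈ K.star s)
    (hF : F ∈ K.interiorFaces s) : FaceSize F (Metric.diam (hull T) / sizeRatio γ) := by
  obtain ⟨hF3, hsF, hFc⟩ := TetMesh.mem_interiorFaces.1 hF
  obtain ⟨A, hA⟩ := Finset.card_pos.1 (zero_lt_one.trans hFc)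
  have hA' := TetMesh.mem_star.1 hA
  have hγ0 := hγ.pos hA'.1
  obtain ⟨x, r, hr, hball, hd⟩ := hγ A hA'.1
  have hle := hγ.diam_le hK hs hT (TetMesh.star_anti hsF hA)
  have hρ0 : 0 < Metric.diam (hull T) / sizeRatio γ :=
    div_pos (TetMesh.diam_pos (TetMesh.mem_star.1 hT).1) (sizeRatio_pos hγ0)
  have hρr : Metric.diam (hull T) / sizeRatio γ ≤ r := by
    rw [div_le_iff₀ (sizeRatio_pos hγ0), sizeRatio]
    refine hle.trans ((mul_le_mul_of_nonneg_left hd (Real.exp_pos _).le).trans (le_of_eq ?_))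
    ring
  have h4 := TetMesh.card_of_mem_tets hA'.1
  have hi := TetMesh.indep_of_mem_tets hA'.1
  refine ⟨hρ0, (TetMesh.mem_simplices.1 hF3).2, ?_, fun i hiF j hjF hij => ?_⟩
  · refine le_trans (mul_le_mul_of_nonneg_right (pow_le_pow_left₀ hρ0.le hρr 2)
      measureReal_nonneg) (area_lower_bound h4 hi hr hball hA'.2 (TetMesh.mem_simplices.1 hF3).2)
  · have := two_mul_radius_le_norm_sub h4 hi hr hball (hA'.2 hjF) (hA'.2 hiF) hij.symm
    linarith

/-- The value and the scaled derivative jumps at a point of an interior face near `T`. -/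
theorem jumps_le {γ : ℝ} (hγ : K.ShapeRegular γ) (hK : K.LocallyFaceConnected)
    {uT : Finset E3 → MvPolynomial (Fin 3) ℝ} (hdeg : ∀ T ∈ K.tets, (uT T).totalDegree ≤ 3)
    {ν : Finset E3 → Fin 2 → E3} (hν : IsEdgeFrame K ν) {η : Finset E3 → Finset E3}
    (hη : IsEdgeChoice K η) {s T F A B : Finset E3} (hs : s ∈ K.faces) (hT : T ∈ K.star s)
    (hF : F ∈ K.interiorFaces s) (hA : A ∈ K.star F) (hB : B ∈ K.star F) {x : E3}
    (hx : x ∈ hull F) :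
    (polyFun (uT A) x - polyFun (uT B) x) ^ 2 ≤
        jumpConst γ * (jumpSq K uT F / Metric.diam (hull T) ^ 2) ∧
      (Metric.diam (hull T) * ‖fderiv ℝ (polyFun (uT A)) x - fderiv ℝ (polyFun (uT B)) x‖) ^ 2 ≤
        jumpConst γ * (jumpSq K uT F / Metric.diam (hull T) ^ 2 +
          (derivJumpSq K uT F (ν (η F) 0) + derivJumpSq K uT F (ν (η F) 1))) ∧
      ∀ v, (Metric.diam (hull T) *
          (fderiv ℝ (polyFun (uT A)) x v - fderiv ℝ (polyFun (uT B)) x v)) ^ 2 ≤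
        jumpConst γ * derivJumpSq K uT F v := by
  have hsize := faceSize_of_mem_interiorFaces hγ hK hs hT hF
  have hd := TetMesh.diam_pos (TetMesh.mem_star.1 hT).1
  have hθ := sizeRatio_pos (hγ.pos (TetMesh.mem_star.1 hT).1)
  have ha := volume_real_refTriangle_pos
  set d := Metric.diam (hull T) with hddef
  set θ := sizeRatio γ with hθdef
  set a := volume.real refTriangle with hadef
  have hC : 40000 / ((d / θ) ^ 2 * a) = 40000 / a * θ ^ 2 / d ^ 2 := by
    field_simp
  have hηF := Finset.mem_powersetCard.1 (hη F (TetMesh.mem_interiorFaces.1 hF).1)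
  have hJ : 0 ≤ jumpSq K uT F := faceJumpSq_nonneg F _
  have hD : ∀ v, 0 ≤ derivJumpSq K uT F v := fun v => faceJumpSq_nonneg F _
  have h1 := sq_value_jump_le hdeg hsize hA hB hx
  have h2 := sq_norm_gradient_jump_le hdeg hsize hA hB hx hν hηF.1 hηF.2
  have h3 := fun v => sq_deriv_jump_le hdeg hsize hA hB hx v
  rw [← hadef, hC] at h1 h2
  simp only [← hadef, hC] at h3
  have hcst : 40000 / a * θ ^ 2 ≤ jumpConst γ := by
    rw [jumpConst, ← hadef, ← hθdef]
    have : 0 ≤ 40000 / a := by positivity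
    nlinarith [mul_nonneg this (sq_nonneg θ), mul_nonneg this (pow_nonneg hθ.le 4)]
  refine ⟨?_, ?_, fun v => ?_⟩
  · refine h1.trans ?_
    calc 40000 / a * θ ^ 2 / d ^ 2 * jumpSq K uT F
        = 40000 / a * θ ^ 2 * (jumpSq K uT F / d ^ 2) := by ring
      _ ≤ _ := mul_le_mul_of_nonneg_right hcst (by positivity)
  · set D := derivJumpSq K uT F (ν (η F) 0) + derivJumpSq K uT F (ν (η F) 1) with hDdef
    have hD0 : 0 ≤ D := add_nonneg (hD _) (hD _)
    rw [mul_pow]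
    refine (mul_le_mul_of_nonneg_left h2 (sq_nonneg d)).trans ?_
    -- The factor `d ^ 2` cancels one power `ρ⁻² = θ² / d²`. The tangential part contains a second
    -- one, which leaves `θ ^ 4 / d ^ 2`, and `2187 = 3 * 729`.
    have he : d ^ 2 * (3 * (40000 / a * θ ^ 2 / d ^ 2) * (729 / (d / θ) ^ 2 * jumpSq K uT F + D)) =
        2187 * (40000 / a) * θ ^ 4 * (jumpSq K uT F / d ^ 2) + 3 * (40000 / a) * θ ^ 2 * D := by
      field_simp
      ring
    rw [he, jumpConst, ← hadef, ← hθdef]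
    have e1 : 0 ≤ (40000 / a) * θ ^ 2 * (jumpSq K uT F / d ^ 2) := by positivity
    have e2 : 0 ≤ (40000 / a) * θ ^ 2 * D := by positivity
    have e3 : 0 ≤ (40000 / a) * θ ^ 4 * D := by positivity
    nlinarith
  · rw [mul_pow]
    refine (mul_le_mul_of_nonneg_left (h3 v) (sq_nonneg d)).trans ?_
    calc d ^ 2 * (40000 / a * θ ^ 2 / d ^ 2 * derivJumpSq K uT F v)
        = 40000 / a * θ ^ 2 * derivJumpSq K uT F v := by field_simp
      _ ≤ _ := mul_le_mul_of_nonneg_right hcst (hD v)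

/-- The squared jumps of `u` around the vertices of `T`. -/
noncomputable def vertexJumps (K : TetMesh) (uT : Finset E3 → MvPolynomial (Fin 3) ℝ)
    (T : Finset E3) : ℝ :=
  ∑ p ∈ T, ∑ F ∈ K.interiorFaces {p}, jumpSq K uT F

/-- The squared jumps of derivatives of `u` around the vertices of `T`. -/
noncomputable def vertexDerivJumps (K : TetMesh) (ν : Finset E3 → Fin 2 → E3)
    (η : Finset E3 → Finset E3) (uT : Finset E3 → MvPolynomial (Fin 3) ℝ) (T : Finset E3) : ℝ :=
  ∑ p ∈ T, ∑ F ∈ K.interiorFaces {p},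
    (derivJumpSq K uT F (ν (η F) 0) + derivJumpSq K uT F (ν (η F) 1))

theorem le_sum_interiorFaces {X : Finset E3 → ℝ} (hX : ∀ F, 0 ≤ X F) {T F : Finset E3} {p : E3}
    (hp : p ∈ T) (hF : F ∈ K.interiorFaces {p}) :
    X F ≤ ∑ p ∈ T, ∑ F ∈ K.interiorFaces {p}, X F :=
  (Finset.single_le_sum (fun F _ => hX F) hF).trans
    (Finset.single_le_sum (f := fun p => ∑ F ∈ K.interiorFaces {p}, X F)
      (fun _ _ => Finset.sum_nonneg fun F _ => hX F) hp)

theorem edgeMid_pair [DecidableEq E3] {i j : E3} (hij : i ≠ j) :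
    edgeMid {i, j} = AffineMap.lineMap i j (1 / 2 : ℝ) := by
  rw [edgeMid, Finset.sum_pair hij, AffineMap.lineMap_apply_module]
  module

theorem edgeMid_mem_hull {e : Finset E3} (he : e.card = 2) : edgeMid e ∈ hull e := by
  classical
  obtain ⟨i, j, hij, rfl⟩ := Finset.card_eq_two.1 he
  rw [edgeMid_pair hij]
  exact (convex_convexHull ℝ _).lineMap_mem (mem_hull (by simp)) (mem_hull (by simp))
    (by norm_num)

theorem hull_subset_closedDomain {T : Finset E3} (hT : T ∈ K.tets) : hull T ⊆ K.closedDomain :=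
  K.convexHull_subset_space (TetMesh.mem_simplices.1 hT).1

theorem uniqueDiffOn_hull {T : Finset E3} (hT : T ∈ K.tets) : UniqueDiffOn ℝ (hull T) := by
  refine uniqueDiffOn_convex (convex_convexHull ℝ _) ?_
  rw [hull, interior_convexHull_nonempty_iff_affineSpan_eq_top]
  exact affineSpan_eq_top_of_card (TetMesh.card_of_mem_tets hT) (TetMesh.indep_of_mem_tets hT)

/-- The gradients of `E(u)` are prescribed within the whole closed domain, whereas the stability
estimate uses derivatives within one tetrahedron; for a C¹ function the two agree. -/
theorem fderivWithin_polyFun_sub {P : MvPolynomial (Fin 3) ℝ} {w : E3 → ℝ} {T : Finset E3}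
    (hT : T ∈ K.tets) (hw : ContDiffOn ℝ 1 w K.closedDomain) {x : E3} (hx : x ∈ hull T) :
    fderivWithin ℝ (fun y => polyFun P y - w y) (hull T) x =
      fderiv ℝ (polyFun P) x - fderivWithin ℝ w K.closedDomain x := by
  have hu := uniqueDiffOn_hull hT x hx
  have hd := hw.differentiableOn (by simp) x (hull_subset_closedDomain hT hx)
  rw [fderivWithin_fun_sub hu (differentiable_polyFun P x).differentiableWithinAt
    (hd.mono (hull_subset_closedDomain hT)),
    fderivWithin_eq_fderiv hu (differentiable_polyFun P x),
    fderivWithin_subset (hull_subset_closedDomain hT) hu hd]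

/-- The number `X` stands for any bound on the normal derivative jumps at the edge midpoints. The
local claim takes the jumps in the frames of the edges of `T`, the global claim takes the vertex
terms. -/
theorem local_estimate {γ : ℝ} (hγ : K.ShapeRegular γ) (hK : K.LocallyFaceConnected)
    {c f : Finset E3 → E3} (hcf : IsWFSplit K c f) {ν : Finset E3 → Fin 2 → E3}
    (hν : IsEdgeFrame K ν) {η : Finset E3 → Finset E3} (hη : IsEdgeChoice K η)
    {uT : Finset E3 → MvPolynomial (Fin 3) ℝ} (hdeg : ∀ T ∈ K.tets, (uT T).totalDegree ≤ 3)
    {w : E3 → ℝ} (hw : IsSmoothing K c f ν uT w) {T : Finset E3} (hT : T ∈ K.tets) {X : ℝ}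
    (hX : 0 ≤ X)
    (hnormal : ∀ e ∈ T.powersetCard 2, ∀ F ∈ K.interiorFaces e, ∀ A ∈ K.star F, ∀ B ∈ K.star F,
      ∀ i, (Metric.diam (hull T) * (fderiv ℝ (polyFun (uT A)) (edgeMid e) (ν e i) -
        fderiv ℝ (polyFun (uT B)) (edgeMid e) (ν e i))) ^ 2 ≤ jumpConst γ * X) :
    ∫ x in hull T, (polyFun (uT T) x - w x) ^ 2 ≤
      localConst γ * (Metric.diam (hull T) ^ 3 *
        (vertexJumps K uT T / Metric.diam (hull T) ^ 2 + vertexDerivJumps K ν η uT T + X)) := by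
  classical
  have hd := TetMesh.diam_pos hT
  have hγ0 := hγ.pos hT
  have hT4 := TetMesh.card_of_mem_tets hT
  have hTi := TetMesh.indep_of_mem_tets hT
  have hc := hcf.isPosComb_center hT
  have hf := hcf.isPosComb_face hT
  set d := Metric.diam (hull T) with hddef
  have hJ : ∀ F, 0 ≤ jumpSq K uT F := fun F => faceJumpSq_nonneg F _
  have hD : ∀ F, 0 ≤ derivJumpSq K uT F (ν (η F) 0) + derivJumpSq K uT F (ν (η F) 1) :=
    fun F => add_nonneg (faceJumpSq_nonneg F _) (faceJumpSq_nonneg F _)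
  have hV0 : 0 ≤ vertexJumps K uT T := Finset.sum_nonneg fun p _ => Finset.sum_nonneg fun F _ => hJ F
  have hG0 : 0 ≤ vertexDerivJumps K ν η uT T :=
    Finset.sum_nonneg fun p _ => Finset.sum_nonneg fun F _ => hD F
  set Q := vertexJumps K uT T / d ^ 2 + vertexDerivJumps K ν η uT T + X with hQ
  have hV0' : 0 ≤ vertexJumps K uT T / d ^ 2 := by positivity
  have hQ0 : 0 ≤ Q := by positivity
  have hj := jumpConst_nonneg γ
  -- One bound for all jumps of values and all jumps of derivatives scaled by `d`.
  set δ := Real.sqrt (jumpConst γ * Q) with hδ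
  have hδ0 : 0 ≤ δ := Real.sqrt_nonneg _
  have hδ2 : δ ^ 2 = jumpConst γ * Q := Real.sq_sqrt (mul_nonneg hj hQ0)
  have hstar : ∀ s ∈ K.faces, ((K.star s).card : ℝ) ≤ starBound γ := fun s hs => by
    rw [starBound]
    exact_mod_cast hγ.card_star_le (K.nonempty_of_mem_faces hs)
  have hvert : ∀ p ∈ T, {p} ∈ K.simplices 1 := fun p hp =>
    TetMesh.mem_simplices_of_subset hT (by simpa using hp) (by simp) one_pos
  have hpT : ∀ p ∈ T, T ∈ K.star {p} := fun p hp => TetMesh.mem_star.2 ⟨hT, by simpa using hp⟩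
  have hval : ∀ p ∈ T, |polyFun (uT T) p - w p| ≤ starBound γ * δ := by
    intro p hp
    have hs := (TetMesh.mem_simplices.1 (hvert p hp)).1
    rw [hw.value p (hvert p hp), ← Real.norm_eq_abs]
    refine TetMesh.norm_sub_average_le hK hs (fun T => polyFun (uT T) p) hδ0 (hstar _ hs)
      (fun F hF A hA B hB => ?_) (hpT p hp)
    have hpF : p ∈ F := by simpa using (TetMesh.mem_interiorFaces.1 hF).2.1
    refine Real.abs_le_sqrt ((jumps_le hγ hK hdeg hν hη hs (hpT p hp) hF hA hB
      (mem_hull hpF)).1.trans (mul_le_mul_of_nonneg_left ?_ hj))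
    have h1 : jumpSq K uT F ≤ vertexJumps K uT T := le_sum_interiorFaces hJ hp hF
    have h2 : jumpSq K uT F / d ^ 2 ≤ vertexJumps K uT T / d ^ 2 := by gcongr
    linarith
  have hgrad : ∀ p ∈ T, d * ‖fderivWithin ℝ (fun y => polyFun (uT T) y - w y) (hull T) p‖ ≤
      starBound γ * δ := by
    intro p hp
    have hs := (TetMesh.mem_simplices.1 (hvert p hp)).1
    rw [fderivWithin_polyFun_sub hT hw.mem.2.1 (mem_hull hp), hw.grad p (hvert p hp)]
    have h1 := TetMesh.norm_sub_average_le hK hs (fun T => fderiv ℝ (polyFun (uT T)) p)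
      (δ := δ / d) (by positivity) (hstar _ hs) (fun F hF A hA B hB => ?_) (hpT p hp)
    · refine (mul_le_mul_of_nonneg_left h1 hd.le).trans (le_of_eq ?_)
      field_simp
    · have hpF : p ∈ F := by simpa using (TetMesh.mem_interiorFaces.1 hF).2.1
      rw [le_div_iff₀ hd, mul_comm]
      refine Real.le_sqrt_of_sq_le ((jumps_le hγ hK hdeg hν hη hs (hpT p hp) hF hA hB
        (mem_hull hpF)).2.1.trans (mul_le_mul_of_nonneg_left ?_ hj))
      have h1 : jumpSq K uT F ≤ vertexJumps K uT T := le_sum_interiorFaces hJ hp hF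
      have h2 : jumpSq K uT F / d ^ 2 ≤ vertexJumps K uT T / d ^ 2 := by gcongr
      have h3 := le_sum_interiorFaces hD hp hF
      rw [← vertexDerivJumps] at h3
      linarith
  have hedges : ∀ i ∈ T, ∀ j ∈ T, i ≠ j → ∃ ν : Fin 2 → E3, Orthonormal ℝ ν ∧
      (∀ l, inner ℝ (ν l) (j - i) = 0) ∧ ∀ l,
        d * |fderivWithin ℝ (fun y => polyFun (uT T) y - w y) (hull T)
          (AffineMap.lineMap i j (1 / 2 : ℝ)) (ν l)| ≤ starBound γ * δ := by
    intro i hi j hj' hij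
    have hsub : {i, j} ⊆ T := by simp [Finset.insert_subset_iff, hi, hj']
    have hcard : ({i, j} : Finset E3).card = 2 := Finset.card_pair hij
    have he := TetMesh.mem_simplices_of_subset hT hsub hcard (by norm_num)
    have hs := (TetMesh.mem_simplices.1 he).1
    obtain ⟨hon, hperp⟩ := hν _ he
    refine ⟨ν {i, j}, hon, fun l => hperp j (by simp) i (by simp) l, fun l => ?_⟩
    rw [← edgeMid_pair hij, fderivWithin_polyFun_sub hT hw.mem.2.1
      (hull_mono hsub (edgeMid_mem_hull hcard)), sub_apply, hw.normal _ he,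
      ← Real.norm_eq_abs]
    have h1 := TetMesh.norm_sub_average_le hK hs
      (fun T => fderiv ℝ (polyFun (uT T)) (edgeMid {i, j}) (ν {i, j} l))
      (δ := δ / d) (by positivity) (hstar _ hs) (fun F hF A hA B hB => ?_)
      (TetMesh.mem_star.2 ⟨hT, hsub⟩)
    · refine (mul_le_mul_of_nonneg_left h1 hd.le).trans (le_of_eq ?_)
      field_simp
    · rw [le_div_iff₀ hd, mul_comm, Real.norm_eq_abs]
      refine Real.le_sqrt_of_sq_le ?_
      rw [mul_pow, sq_abs, ← mul_pow]
      refine (hnormal {i, j} (Finset.mem_powersetCard.2 ⟨hsub, hcard⟩) F hF A hA B hB l).trans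
        (mul_le_mul_of_nonneg_left ?_ hj)
      linarith
  have hsep : ∀ i ∈ T, ∀ j ∈ T, i ≠ j → d ≤ γ * ‖j - i‖ := by
    intro i hi j hj' hij
    obtain ⟨x, r, hr, hball, hdr⟩ := hγ T hT
    have := two_mul_radius_le_norm_sub hT4 hTi hr hball hj' hi hij.symm
    exact hdr.trans (mul_le_mul_of_nonneg_left (by linarith) hγ0.le)
  have hbound : ∀ x ∈ hull T, |polyFun (uT T) x - w x| ≤ (6 + 4 * γ) * (starBound γ * δ) :=
    fun x hx => ((hw.mem.2.2 T hT).polyFun_sub (hdeg T hT)).abs_le_of_dofs hT4 hTi hc hf hγ0.le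
      (fun x hx y hy => TetMesh.norm_sub_le_diam hx hy) hsep hval hgrad hedges hx
  have hvol : volume.real (hull T) ≤ d ^ 3 * volume.real (Metric.closedBall (0 : E3) 1) := by
    obtain ⟨p, hp⟩ := Finset.card_pos.1 (by rw [hT4]; norm_num : 0 < T.card)
    have hsub : hull T ⊆ Metric.closedBall p d := fun x hx => by
      rw [mem_closedBall_iff_norm]
      exact TetMesh.norm_sub_le_diam hx (mem_hull hp)
    refine (measureReal_mono hsub measure_closedBall_lt_top.ne).trans (le_of_eq ?_)
    rw [Measure.real, Measure.addHaar_closedBall' _ _ hd.le, ENNReal.toReal_mul,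
      ENNReal.toReal_ofReal (by positivity), finrank_euclideanSpace, Fintype.card_fin, Measure.real]
  have hint := norm_setIntegral_le_of_norm_le_const (μ := volume)
    (f := fun x => (polyFun (uT T) x - w x) ^ 2) (C := ((6 + 4 * γ) * (starBound γ * δ)) ^ 2)
    (TetMesh.isCompact_hull T).measure_lt_top (fun x hx => by
      rw [Real.norm_of_nonneg (sq_nonneg _), ← sq_abs]
      exact pow_le_pow_left₀ (abs_nonneg _) (hbound x hx) 2)
  refine (le_abs_self _).trans (hint.trans ((mul_le_mul_of_nonneg_left hvol
    (sq_nonneg _)).trans (le_of_eq ?_)))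
  rw [mul_pow, mul_pow, hδ2, localConst, mul_pow]
  ring

end WF

namespace WF

/-! ### The global estimate -/

variable {K : TetMesh}

theorem diam_le_meshSize {T : Finset E3} (hT : T ∈ K.tets) :
    Metric.diam (hull T) ≤ K.meshSize :=
  le_csSup (K.tets.finite_toSet.image _).bddAbove ⟨T, hT, rfl⟩

theorem domain_subset : K.domain ⊆ ⋃ T ∈ K.tets, hull T := by
  intro x hx
  obtain ⟨s, hs, hxs⟩ := K.toSimplicialComplex.mem_space_iff.1 (interior_subset hx)
  obtain ⟨T, hT, hsT, hcard⟩ := K.pure s hs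
  exact Set.mem_iUnion₂.2 ⟨T, TetMesh.mem_simplices.2 ⟨hT, hcard⟩, hull_mono hsT hxs⟩

/-- For a nonnegative integrand covering suffices, so the overlaps of neighbouring tetrahedra need
no attention. -/
theorem setIntegral_le_sum_of_subset_biUnion {α ι : Type*} [MeasurableSpace α] {μ : Measure α}
    {s : Finset ι} {D : Set α} {S : ι → Set α} (hD : MeasurableSet D)
    (hS : ∀ i ∈ s, MeasurableSet (S i)) (hsub : D ⊆ ⋃ i ∈ s, S i) {g : α → ℝ} (hg : ∀ x, 0 ≤ g x)
    (hint : ∀ i ∈ s, IntegrableOn g (S i) μ) :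
    ∫ x in D, g x ∂μ ≤ ∑ i ∈ s, ∫ x in S i, g x ∂μ := by
  have h1 : ∀ i ∈ s, Integrable ((S i).indicator g) μ := fun i hi =>
    (hint i hi).integrable_indicator (hS i hi)
  have h2 : ∑ i ∈ s, ∫ x in S i, g x ∂μ = ∫ x, ∑ i ∈ s, (S i).indicator g x ∂μ := by
    rw [integral_finsetSum _ h1]
    exact Finset.sum_congr rfl fun i hi => (integral_indicator (hS i hi)).symm
  rw [h2, ← integral_indicator hD]
  refine integral_mono_of_nonneg (Filter.Eventually.of_forall fun x =>
    Set.indicator_nonneg (fun x _ => hg x) x) (integrable_finsetSum _ h1)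
    (Filter.Eventually.of_forall fun x => ?_)
  have h0 : ∀ i ∈ s, 0 ≤ (S i).indicator g x := fun i _ =>
    Set.indicator_nonneg (fun x _ => hg x) x
  by_cases hx : x ∈ D
  · obtain ⟨i, hi, hxi⟩ := Set.mem_iUnion₂.1 (hsub hx)
    simp only [Set.indicator_of_mem hx]
    refine le_trans (le_of_eq ?_) (Finset.single_le_sum h0 hi)
    rw [Set.indicator_of_mem hxi]
  · simp only [Set.indicator_of_notMem hx]
    exact Finset.sum_nonneg h0

/-- Every face is counted a bounded number of times in the sum of the local estimates. -/
theorem sum_vertex_interiorFaces_le {γ : ℝ} (hγ : K.ShapeRegular γ) {X : Finset E3 → ℝ}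
    (hX : ∀ F, 0 ≤ X F) :
    ∑ T ∈ K.tets, ∑ p ∈ T, ∑ F ∈ K.interiorFaces {p}, X F ≤
      3 * starBound γ * ∑ F ∈ K.simplices 3, X F := by
  classical
  have h1 : ∀ p, ∑ F ∈ K.interiorFaces {p}, X F ≤
      ∑ F ∈ K.simplices 3, if p ∈ F then X F else 0 := by
    intro p
    rw [← Finset.sum_filter]
    refine Finset.sum_le_sum_of_subset_of_nonneg (fun F hF => ?_) fun F _ _ => hX F
    obtain ⟨hF3, hpF, -⟩ := TetMesh.mem_interiorFaces.1 hF
    exact Finset.mem_filter.2 ⟨hF3, by simpa using hpF⟩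
  -- Exchanging the sums, the incidences of a vertex with `T` and `F` are counted from `F`: three
  -- vertices, each in at most `starBound γ` tetrahedra.
  have h2 : ∀ T ∈ K.tets, ∑ p ∈ T, ∑ F ∈ K.interiorFaces {p}, X F ≤
      ∑ F ∈ K.simplices 3, ∑ p ∈ F, if p ∈ T then X F else 0 := by
    intro T _
    refine (Finset.sum_le_sum fun p _ => h1 p).trans (le_of_eq ?_)
    rw [Finset.sum_comm]
    refine Finset.sum_congr rfl fun F _ => ?_
    rw [Finset.sum_ite_mem, Finset.sum_ite_mem, Finset.inter_comm]
  refine (Finset.sum_le_sum h2).trans ?_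
  rw [Finset.sum_comm, Finset.mul_sum]
  refine Finset.sum_le_sum fun F hF => ?_
  rw [Finset.sum_comm]
  have h3 : ∀ p ∈ F, ∑ T ∈ K.tets, (if p ∈ T then X F else 0) ≤ starBound γ * X F := by
    intro p _
    rw [← Finset.sum_filter, Finset.sum_const, nsmul_eq_mul]
    refine mul_le_mul_of_nonneg_right ?_ (hX F)
    rw [starBound]
    have hle := hγ.card_star_le (Finset.singleton_nonempty p)
    have hsub : K.tets.filter (fun T => p ∈ T) ⊆ K.star {p} := fun T hT =>
      TetMesh.mem_star.2 ⟨(Finset.mem_filter.1 hT).1, by simpa using (Finset.mem_filter.1 hT).2⟩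
    exact_mod_cast (Finset.card_le_card hsub).trans hle
  refine (Finset.sum_le_sum h3).trans (le_of_eq ?_)
  rw [Finset.sum_const, (TetMesh.mem_simplices.1 hF).2, nsmul_eq_mul]
  push_cast
  ring

variable {c f : Finset E3 → E3} {ν : Finset E3 → Fin 2 → E3} {η : Finset E3 → Finset E3}
  {uT : Finset E3 → MvPolynomial (Fin 3) ℝ} {w u : E3 → ℝ} {γ : ℝ}

theorem vertexJumps_nonneg (T : Finset E3) : 0 ≤ vertexJumps K uT T :=
  Finset.sum_nonneg fun _ _ => Finset.sum_nonneg fun F _ => faceJumpSq_nonneg F _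

theorem vertexDerivJumps_nonneg (T : Finset E3) : 0 ≤ vertexDerivJumps K ν η uT T :=
  Finset.sum_nonneg fun _ _ => Finset.sum_nonneg fun F _ =>
    add_nonneg (faceJumpSq_nonneg F _) (faceJumpSq_nonneg F _)

/-- The volume factor `h_T³` turns `h_T⁻²` into `h_T`; only then is `h_T` replaced by the larger
`h`. -/
theorem cube_mul_le {T : Finset E3} (hT : T ∈ K.tets) {a b : ℝ} (ha : 0 ≤ a) (hb : 0 ≤ b) :
    Metric.diam (hull T) ^ 3 * (a / Metric.diam (hull T) ^ 2 + b) ≤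
      K.meshSize * a + K.meshSize ^ 3 * b := by
  have hd := TetMesh.diam_pos hT
  have hle := diam_le_meshSize hT
  have h1 : Metric.diam (hull T) ^ 3 * (a / Metric.diam (hull T) ^ 2 + b) =
      Metric.diam (hull T) * a + Metric.diam (hull T) ^ 3 * b := by
    field_simp
  rw [h1]
  gcongr

theorem local_estimate_of_edges (hγ : K.ShapeRegular γ) (hK : K.LocallyFaceConnected)
    (hcf : IsWFSplit K c f) (hν : IsEdgeFrame K ν) (hη : IsEdgeChoice K η)
    (hdeg : ∀ T ∈ K.tets, (uT T).totalDegree ≤ 3) (hw : IsSmoothing K c f ν uT w)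
    {T : Finset E3} (hT : T ∈ K.tets) :
    ∫ x in hull T, (polyFun (uT T) x - w x) ^ 2 ≤ localConst γ *
      ((∑ p ∈ T, ∑ F ∈ K.interiorFaces {p}, K.meshSize * jumpSq K uT F) +
        (∑ p ∈ T, ∑ F ∈ K.interiorFaces {p}, K.meshSize ^ 3 *
          (derivJumpSq K uT F (ν (η F) 0) + derivJumpSq K uT F (ν (η F) 1))) +
        ∑ e ∈ T.powersetCard 2, ∑ F ∈ K.interiorFaces e, K.meshSize ^ 3 *
          (derivJumpSq K uT F (ν e 0) + derivJumpSq K uT F (ν e 1))) := by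
  have hD : ∀ F v, 0 ≤ derivJumpSq K uT F v := fun F v => faceJumpSq_nonneg F _
  set X := ∑ e ∈ T.powersetCard 2, ∑ F ∈ K.interiorFaces e,
    (derivJumpSq K uT F (ν e 0) + derivJumpSq K uT F (ν e 1)) with hXdef
  have hX : 0 ≤ X := Finset.sum_nonneg fun e _ => Finset.sum_nonneg fun F _ =>
    add_nonneg (hD F _) (hD F _)
  refine (local_estimate hγ hK hcf hν hη hdeg hw hT hX
    fun e he F hF A hA B hB i => ?_).trans (mul_le_mul_of_nonneg_left ?_ (localConst_nonneg γ))
  · have he' := Finset.mem_powersetCard.1 he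
    have hs := (TetMesh.mem_simplices.1 (TetMesh.mem_simplices_of_subset hT he'.1 he'.2
      (by norm_num))).1
    have hmid := hull_mono (TetMesh.mem_interiorFaces.1 hF).2.1 (edgeMid_mem_hull he'.2)
    refine ((jumps_le hγ hK hdeg hν hη hs (TetMesh.mem_star.2 ⟨hT, he'.1⟩) hF hA hB hmid).2.2
      (ν e i)).trans (mul_le_mul_of_nonneg_left ?_ (jumpConst_nonneg γ))
    have h1 : derivJumpSq K uT F (ν e i) ≤
        derivJumpSq K uT F (ν e 0) + derivJumpSq K uT F (ν e 1) := by
      fin_cases i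
      · exact le_add_of_nonneg_right (hD F _)
      · exact le_add_of_nonneg_left (hD F _)
    refine h1.trans ((Finset.single_le_sum (f := fun F =>
      derivJumpSq K uT F (ν e 0) + derivJumpSq K uT F (ν e 1))
      (fun F _ => add_nonneg (hD F _) (hD F _)) hF).trans ?_)
    exact Finset.single_le_sum (f := fun e => ∑ F ∈ K.interiorFaces e,
      (derivJumpSq K uT F (ν e 0) + derivJumpSq K uT F (ν e 1)))
      (fun e _ => Finset.sum_nonneg fun F _ => add_nonneg (hD F _) (hD F _)) he
  · rw [add_assoc]
    refine (cube_mul_le hT (vertexJumps_nonneg T)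
      (add_nonneg (vertexDerivJumps_nonneg T) hX)).trans (le_of_eq ?_)
    simp only [vertexJumps, vertexDerivJumps, hXdef, ← Finset.mul_sum]
    ring

/-- The normal derivative jump at a midpoint is at most the full gradient jump, which is controlled
on each face by the jump of `u` and the frame of the chosen edge. The midpoint terms are thus
absorbed into the vertex terms, at the price of a factor 2. -/
theorem local_estimate_of_vertices (hγ : K.ShapeRegular γ) (hK : K.LocallyFaceConnected)
    (hcf : IsWFSplit K c f) (hν : IsEdgeFrame K ν) (hη : IsEdgeChoice K η)
    (hdeg : ∀ T ∈ K.tets, (uT T).totalDegree ≤ 3) (hw : IsSmoothing K c f ν uT w)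
    {T : Finset E3} (hT : T ∈ K.tets) :
    ∫ x in hull T, (polyFun (uT T) x - w x) ^ 2 ≤ 2 * localConst γ *
      (K.meshSize * vertexJumps K uT T + K.meshSize ^ 3 * vertexDerivJumps K ν η uT T) := by
  have hd := TetMesh.diam_pos hT
  have hD : ∀ F, 0 ≤ derivJumpSq K uT F (ν (η F) 0) + derivJumpSq K uT F (ν (η F) 1) :=
    fun F => add_nonneg (faceJumpSq_nonneg F _) (faceJumpSq_nonneg F _)
  have hV0 : 0 ≤ vertexJumps K uT T := vertexJumps_nonneg T
  have hG0 : 0 ≤ vertexDerivJumps K ν η uT T := vertexDerivJumps_nonneg T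
  refine (local_estimate hγ hK hcf hν hη hdeg hw hT
    (X := vertexJumps K uT T / Metric.diam (hull T) ^ 2 + vertexDerivJumps K ν η uT T)
    (by positivity) fun e he F hF A hA B hB i => ?_).trans ?_
  · have he' := Finset.mem_powersetCard.1 he
    have heK := TetMesh.mem_simplices_of_subset hT he'.1 he'.2 (by norm_num)
    have hs := (TetMesh.mem_simplices.1 heK).1
    have hmid := hull_mono (TetMesh.mem_interiorFaces.1 hF).2.1 (edgeMid_mem_hull he'.2)
    obtain ⟨p, hp⟩ := K.nonempty_of_mem_faces hs
    have hF' := TetMesh.interiorFaces_anti (Finset.singleton_subset_iff.2 hp) hF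
    have h1 := (jumps_le hγ hK hdeg hν hη hs (TetMesh.mem_star.2 ⟨hT, he'.1⟩) hF hA hB hmid).2.1
    have h2 : |fderiv ℝ (polyFun (uT A)) (edgeMid e) (ν e i) -
        fderiv ℝ (polyFun (uT B)) (edgeMid e) (ν e i)| ≤
        ‖fderiv ℝ (polyFun (uT A)) (edgeMid e) - fderiv ℝ (polyFun (uT B)) (edgeMid e)‖ := by
      have := (fderiv ℝ (polyFun (uT A)) (edgeMid e) -
        fderiv ℝ (polyFun (uT B)) (edgeMid e)).le_opNorm (ν e i)
      rwa [(hν e heK).1.1 i, mul_one] at this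
    have h3 : (Metric.diam (hull T) * (fderiv ℝ (polyFun (uT A)) (edgeMid e) (ν e i) -
        fderiv ℝ (polyFun (uT B)) (edgeMid e) (ν e i))) ^ 2 ≤ (Metric.diam (hull T) *
        ‖fderiv ℝ (polyFun (uT A)) (edgeMid e) - fderiv ℝ (polyFun (uT B)) (edgeMid e)‖) ^ 2 := by
      rw [mul_pow, mul_pow, ← sq_abs (fderiv ℝ (polyFun (uT A)) (edgeMid e) (ν e i) - _)]
      gcongr
    refine h3.trans (h1.trans (mul_le_mul_of_nonneg_left ?_ (jumpConst_nonneg γ)))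
    have h4 : jumpSq K uT F ≤ vertexJumps K uT T :=
      le_sum_interiorFaces (fun F => faceJumpSq_nonneg F _) (he'.1 hp) hF'
    have h5 : derivJumpSq K uT F (ν (η F) 0) + derivJumpSq K uT F (ν (η F) 1) ≤
        vertexDerivJumps K ν η uT T := le_sum_interiorFaces hD (he'.1 hp) hF'
    gcongr
  · have h1 := cube_mul_le hT hV0 hG0
    rw [← two_mul, mul_left_comm _ (2 : ℝ), ← mul_assoc _ (2 : ℝ), mul_comm _ (2 : ℝ)]
    exact mul_le_mul_of_nonneg_left h1 (mul_nonneg two_pos.le (localConst_nonneg γ))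

theorem IsPiecewisePoly.setIntegral_eq {k : ℕ} (hu : IsPiecewisePoly K k u uT) {T : Finset E3}
    (hT : T ∈ K.tets) :
    ∫ x in hull T, (u x - w x) ^ 2 = ∫ x in hull T, (polyFun (uT T) x - w x) ^ 2 := by
  refine integral_congr_ae ?_
  filter_upwards [(hu.2 T hT).2] with x hx
  rw [hx]

theorem IsPiecewisePoly.integrableOn {k : ℕ} (hu : IsPiecewisePoly K k u uT)
    (hw : ContDiffOn ℝ 1 w K.closedDomain) {T : Finset E3} (hT : T ∈ K.tets) :
    IntegrableOn (fun x => (u x - w x) ^ 2) (hull T) := by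
  have h1 : IntegrableOn (fun x => (polyFun (uT T) x - w x) ^ 2) (hull T) :=
    (((differentiable_polyFun (uT T)).continuous.continuousOn.sub
      (hw.continuousOn.mono (hull_subset_closedDomain hT))).pow 2).integrableOn_compact
      (TetMesh.isCompact_hull T)
  refine h1.congr ?_
  filter_upwards [(hu.2 T hT).2] with x hx
  rw [hx]

/-- Summing the vertex form of the local estimate avoids the frames of all other edges of a face.
The factor 6 combines the 2 of that estimate with the three vertices of a face. -/
theorem global_estimate (hγ : K.ShapeRegular γ) (hK : K.LocallyFaceConnected)
    (hcf : IsWFSplit K c f) (hν : IsEdgeFrame K ν) (hη : IsEdgeChoice K η) {k : ℕ} (hk : k ≤ 3)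
    (hu : IsPiecewisePoly K k u uT) (hw : IsSmoothing K c f ν uT w) :
    ∫ x in K.domain, (u x - w x) ^ 2 ≤ 6 * localConst γ * starBound γ *
      ((∑ F ∈ K.simplices 3, K.meshSize * jumpSq K uT F) +
        ∑ F ∈ K.simplices 3, K.meshSize ^ 3 *
          (derivJumpSq K uT F (ν (η F) 0) + derivJumpSq K uT F (ν (η F) 1))) := by
  have hdeg : ∀ T ∈ K.tets, (uT T).totalDegree ≤ 3 := fun T hT => (hu.2 T hT).1.trans hk
  have hh : 0 ≤ K.meshSize := Real.sSup_nonneg fun x hx => by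
    obtain ⟨T, -, rfl⟩ := hx
    exact Metric.diam_nonneg
  have h1 := sum_vertex_interiorFaces_le hγ (X := fun F => jumpSq K uT F)
    (fun F => faceJumpSq_nonneg F _)
  have h2 := sum_vertex_interiorFaces_le hγ
    (X := fun F => derivJumpSq K uT F (ν (η F) 0) + derivJumpSq K uT F (ν (η F) 1))
    (fun F => add_nonneg (faceJumpSq_nonneg F _) (faceJumpSq_nonneg F _))
  calc ∫ x in K.domain, (u x - w x) ^ 2
      ≤ ∑ T ∈ K.tets, ∫ x in hull T, (u x - w x) ^ 2 :=
        setIntegral_le_sum_of_subset_biUnion isOpen_interior.measurableSet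
          (fun T _ => (TetMesh.isCompact_hull T).measurableSet) domain_subset
          (fun x => sq_nonneg _) fun T hT => hu.integrableOn hw.mem.2.1 hT
    _ ≤ ∑ T ∈ K.tets, 2 * localConst γ *
        (K.meshSize * vertexJumps K uT T + K.meshSize ^ 3 * vertexDerivJumps K ν η uT T) :=
        Finset.sum_le_sum fun T hT => by
          rw [hu.setIntegral_eq hT]
          exact local_estimate_of_vertices hγ hK hcf hν hη hdeg hw hT
    _ = 2 * localConst γ * (K.meshSize * ∑ T ∈ K.tets, vertexJumps K uT T +
          K.meshSize ^ 3 * ∑ T ∈ K.tets, vertexDerivJumps K ν η uT T) := by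
        rw [← Finset.mul_sum, Finset.sum_add_distrib, ← Finset.mul_sum, ← Finset.mul_sum]
    _ ≤ 2 * localConst γ * (K.meshSize * (3 * starBound γ * ∑ F ∈ K.simplices 3, jumpSq K uT F) +
          K.meshSize ^ 3 * (3 * starBound γ * ∑ F ∈ K.simplices 3,
            (derivJumpSq K uT F (ν (η F) 0) + derivJumpSq K uT F (ν (η F) 1)))) :=
        mul_le_mul_of_nonneg_left (add_le_add (mul_le_mul_of_nonneg_left h1 hh)
          (mul_le_mul_of_nonneg_left h2 (pow_nonneg hh 3)))
          (mul_nonneg two_pos.le (localConst_nonneg γ))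
    _ = _ := by
        rw [← Finset.mul_sum, ← Finset.mul_sum]
        ring

end WF

/-! ### The main theorem -/

theorem mainTheorem2 (γ : ℝ) :
    ∃ C : ℝ, 0 < C ∧
      ∀ K : WF.TetMesh, K.ShapeRegular γ → K.LocallyFaceConnected →
      ∀ c f : Finset WF.E3 → WF.E3, WF.IsWFSplit K c f →
      ∀ ν : Finset WF.E3 → Fin 2 → WF.E3, WF.IsEdgeFrame K ν →
      ∀ η : Finset WF.E3 → Finset WF.E3, WF.IsEdgeChoice K η →
      ∀ k : ℕ, 1 ≤ k → k ≤ 3 →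
      ∀ (u : WF.E3 → ℝ) (uT : Finset WF.E3 → MvPolynomial (Fin 3) ℝ),
        WF.IsPiecewisePoly K k u uT →
      ∀ w : WF.E3 → ℝ, WF.IsSmoothing K c f ν uT w →
        (∀ T ∈ K.tets,
          (∫ x in WF.hull T, (u x - w x) ^ 2) ≤
            C * ((∑ p ∈ T, ∑ F ∈ K.interiorFaces {p}, K.meshSize * WF.jumpSq K uT F)
              + (∑ p ∈ T, ∑ F ∈ K.interiorFaces {p}, K.meshSize ^ 3 *
                  (WF.derivJumpSq K uT F (ν (η F) 0) + WF.derivJumpSq K uT F (ν (η F) 1)))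
              + ∑ e ∈ T.powersetCard 2, ∑ F ∈ K.interiorFaces e, K.meshSize ^ 3 *
                  (WF.derivJumpSq K uT F (ν e 0) + WF.derivJumpSq K uT F (ν e 1)))) ∧
        (∫ x in K.domain, (u x - w x) ^ 2) ≤
          C * ((∑ F ∈ K.simplices 3, K.meshSize * WF.jumpSq K uT F)
            + ∑ F ∈ K.simplices 3, K.meshSize ^ 3 *
                (WF.derivJumpSq K uT F (ν (η F) 0) + WF.derivJumpSq K uT F (ν (η F) 1))) := by
  have hL := WF.localConst_nonneg γ
  have hN : 0 ≤ WF.starBound γ := Nat.cast_nonneg _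
  have hLN : 0 ≤ 6 * WF.localConst γ * WF.starBound γ := by positivity
  -- The sum dominates both the local and the global constant; the summand 1 secures positivity for
  -- every `γ`.
  refine ⟨WF.localConst γ + 6 * WF.localConst γ * WF.starBound γ + 1, by positivity, ?_⟩
  intro K hγ hK c f hcf ν hν η hη k _ hk u uT hu w hw
  have hh : 0 ≤ K.meshSize := Real.sSup_nonneg fun x hx => by
    obtain ⟨T, -, rfl⟩ := hx
    exact Metric.diam_nonneg
  have hJ : ∀ F, 0 ≤ K.meshSize * WF.jumpSq K uT F := fun F =>
    mul_nonneg hh (WF.faceJumpSq_nonneg F _)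
  have hD : ∀ F v v', 0 ≤ K.meshSize ^ 3 * (WF.derivJumpSq K uT F v + WF.derivJumpSq K uT F v') :=
    fun F v v' => mul_nonneg (pow_nonneg hh 3)
      (add_nonneg (WF.faceJumpSq_nonneg F _) (WF.faceJumpSq_nonneg F _))
  refine ⟨fun T hT => ?_, ?_⟩
  · rw [hu.setIntegral_eq hT]
    refine (WF.local_estimate_of_edges hγ hK hcf hν hη (fun T hT => (hu.2 T hT).1.trans hk) hw
      hT).trans (mul_le_mul_of_nonneg_right (by linarith) (add_nonneg (add_nonneg ?_ ?_) ?_))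
    · exact Finset.sum_nonneg fun p _ => Finset.sum_nonneg fun F _ => hJ F
    · exact Finset.sum_nonneg fun p _ => Finset.sum_nonneg fun F _ => hD F _ _
    · exact Finset.sum_nonneg fun e _ => Finset.sum_nonneg fun F _ => hD F _ _
  · refine (WF.global_estimate hγ hK hcf hν hη hk hu hw).trans
      (mul_le_mul_of_nonneg_right (by linarith) (add_nonneg ?_ ?_))
    · exact Finset.sum_nonneg fun F _ => hJ F
    · exact Finset.sum_nonneg fun F _ => hD F _ _
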